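/- Let $\mathbb T=\mathbb R/\mathbb Z$, let $N\ge 1$, and let $K(x)=\frac{x^2-|x|}{2}$ for $x\in[-\frac12,\frac12]$, extended $1$-periodically. For a configuration $X=(x_1,\dots,x_N)\in\mathbb T^N$ put $\mu_X=\frac1N\sum_{j=1}^N\delta_{x_j}$, and let $\tilde V_X,\hat V_X\in H^1(\mathbb T)$, with $\int_{\mathbb T}\tilde V_X\,dx=0$, be the solution (in the sense of distributions) of $$-\tilde V_X''=\mu_X-1,\qquad -\hat V_X''=1-e^{\tilde V_X+\hat V_X}.$$ Write $V_X=\tilde V_X+\hat V_X$ and $m_X=e^{V_X}$ (also for the measure $m_X\,dx$), and define $$\mathscr H_N=-\frac12\sum_{k=1}^N\Delta_{x_k}+\mathscr I_X+\mathscr V_X,\qquad \mathscr I_X=N\int_{\mathbb T}V_X m_X\,dx,\qquad \mathscr V_X=\frac N2\iint_{\mathbb T\times\mathbb T}K(x-y)\,(\mu_X-m_X)^{\otimes 2}(dx\,dy),$$ where $\mathscr I_X$ and $\mathscr V_X$ act on $L^2(\mathbb T^N;\mathbb C)$ as operators of multiplication by functions of $X\in\mathbb T^N$; thus $\mathscr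 H_N$ is defined on those $\psi\in H^2(\mathbb T^N)$ for which $(\mathscr I_X+\mathscr V_X)\psi\in L^2(\mathbb T^N)$. Then the domain of $\mathscr H_N$ is all of $H^2(\mathbb T^N)$, and $\mathscr H_N$ is self-adjoint on it. Consequently, let $R^{\mathrm{in}}$ be a symmetric density operator on $L^2(\mathbb T^N)$, i.e. a bounded operator with $R^{\mathrm{in}}=(R^{\mathrm{in}})^*\ge 0$, $\operatorname{tr}R^{\mathrm{in}}=1$, and $U_\sigma R^{\mathrm{in}}U_\sigma^*=R^{\mathrm{in}}$ for every permutation $\sigma$ of $\{1,\dots,N\}$, where $(U_\sigma\psi)(x_1,\dots,x_N)=\psi(x_{\sigma^{-1}(1)},\dots,x_{\sigma^{-1}(N)})$. Suppose that $$\operatorname{tr}\big((-\Delta_N)^2R^{\mathrm{in}}\big):=\sum_{k\in\mathbb Z^N}(4\pi^2|k|^2)^2\langle e_k,R^{\mathrm{in}}e_k\rangle<\infty,\qquad e_k(X)=e^{2\pi i k\cdot X}.$$ Then the Cauchy problem $$i\,\partial_tR(t)=[\mathscr H_N,R(t)],\qquad R(0)=R^{\mathrm{in}},$$ has a solution on $[0,\infty)$,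 and for every $T>0$ every solution on $[0,T]$ coincides with it on $[0,T]$. Here a solution on a time interval $I$ is a family $(R(t))_{t\in I}$ of symmetric density operators that map $H^2(\mathbb T^N)$ into itself, such that for every $\varphi\in H^2(\mathbb T^N)$ and $t\in I$ the map $t\mapsto R(t)\varphi\in L^2(\mathbb T^N)$ is differentiable at $t$ (one-sidedly at end points) with $i\,\partial_tR(t)\varphi=\mathscr H_NR(t)\varphi-R(t)\mathscr H_N\varphi$. -/

import Mathlib

open MeasureTheory Set
open scoped ENNReal ContDiff

noncomputable section

namespace VonNeumann

/-- The `1`-periodic circle `𝕋 = ℝ / ℤ`. -/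
abbrev Circ : Type := UnitAddCircle

/-- The Lebesgue (probability) measure `dx` on `𝕋`. -/
abbrev dx : Measure Circ := AddCircle.haarAddCircle

/-- The configuration space `𝕋^N`. -/
abbrev Config (N : ℕ) : Type := UnitAddTorus (Fin N)

/-- The Lebesgue (probability) measure `dX_N` on `𝕋^N`. -/
abbrev dX (N : ℕ) : Measure (Config N) := Measure.pi fun _ => dx

/-! ### The Poisson–Boltzmann potential of a configuration -/

/-- The empirical measure `μ_X = (1/N) ∑ j, δ_{x_j}`. -/
def empirical {N : ℕ} (X : Config N) : Measure Circ :=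
  (N : ℝ≥0∞)⁻¹ • ∑ j, Measure.dirac (X j)

/-- Membership of (the class of) a real function in the Sobolev space `H¹(𝕋)`:
`f ∈ L²` and `∑ k, (1 + k²) |f̂(k)|² < ∞`. -/
def MemH1 (f : Circ → ℝ) : Prop :=
  MemLp f 2 dx ∧
    Summable fun k : ℤ => (1 + (k : ℝ) ^ 2) * ‖fourierCoeff (fun x => (f x : ℂ)) k‖ ^ 2

/-- Smooth test functions on `𝕋`, i.e. those with a smooth periodic lift to `ℝ`. -/
def IsTest (φ : Circ → ℝ) : Prop := ContDiff ℝ ∞ fun t : ℝ => φ (t : Circ)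

/-- The second derivative of a function on `𝕋`. -/
def secondDeriv (φ : Circ → ℝ) (x : Circ) : ℝ :=
  iteratedDeriv 2 (fun t : ℝ => φ (x + (t : Circ))) 0

/-- `-V'' = μ - f` in the sense of distributions on `𝕋`. -/
def WeakPoisson (V : Circ → ℝ) (μ : Measure Circ) (f : Circ → ℝ) : Prop :=
  ∀ φ : Circ → ℝ, IsTest φ →
    -(∫ x, V x * secondDeriv φ x ∂dx) = (∫ x, φ x ∂μ) - ∫ x, f x * φ x ∂dx

/-- `(Vt, Vh)` solves, for the configuration `X`,
`-Vt'' = μ_X - 1`, `-Vh'' = 1 - exp (Vt + Vh)` with `Vt, Vh ∈ H¹(𝕋)` and `Vt` of zero mean. -/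
structure IsPoissonBoltzmann {N : ℕ} (X : Config N) (Vt Vh : Circ → ℝ) : Prop where
  memH1_tilde : MemH1 Vt
  mean_zero : ∫ x, Vt x ∂dx = 0
  eq_tilde : WeakPoisson Vt (empirical X) fun _ => 1
  memH1_hat : MemH1 Vh
  eq_hat : WeakPoisson Vh dx fun x => Real.exp (Vt x + Vh x)

/-! ### The interaction terms -/

/-- The Green function of the Laplacian on `𝕋`, `K(x) = (x² - |x|) / 2`. Here `‖x‖` is the distance
to `0` on the circle, i.e. `|x|` for the representative of `x` in `[-1/2, 1/2]`; the expression
`(x² - |x|) / 2` on `[-1, 1]` is `1`-periodic. -/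
def green (x : Circ) : ℝ := (‖x‖ ^ 2 - ‖x‖) / 2

/-- `∬ K(x - y) μ(dx) ν(dy)`. -/
def greenPairing (μ ν : Measure Circ) : ℝ := ∫ x, ∫ y, green (x - y) ∂ν ∂μ

/-- The measure `m = exp (V) dx`. -/
def gibbs (V : Circ → ℝ) : Measure Circ := dx.withDensity fun x => ENNReal.ofReal (Real.exp (V x))

/-- `𝓘_X = N ∫ V_X exp (V_X) dx`. -/
def entropyTerm {N : ℕ} (V : Config N → Circ → ℝ) (X : Config N) : ℝ :=
  N * ∫ x, V X x * Real.exp (V X x) ∂dx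

/-- `𝓥_X = (N / 2) ∬ K(x - y) (μ_X - m_X)^{⊗ 2}(dx dy)`, with the square expanded. -/
def interactionTerm {N : ℕ} (V : Config N → Circ → ℝ) (X : Config N) : ℝ :=
  (N : ℝ) / 2 *
    (greenPairing (empirical X) (empirical X) - greenPairing (empirical X) (gibbs (V X))
      - greenPairing (gibbs (V X)) (empirical X) + greenPairing (gibbs (V X)) (gibbs (V X)))

/-! ### The Hilbert space and the Hamiltonian -/

/-- The Hilbert space `L²(𝕋^N; ℂ)`. -/
abbrev L2 (N : ℕ) : Type := Lp ℂ 2 (dX N)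

/-- The orthonormal basis of exponentials `e_k(X) = exp (2πi k · X)`, `k ∈ ℤ^N`. -/
def expBasis (N : ℕ) : HilbertBasis (Fin N → ℤ) ℂ (L2 N) := UnitAddTorus.mFourierBasis

/-- `|k|²` for `k ∈ ℤ^N`. -/
def freqSq {N : ℕ} (k : Fin N → ℤ) : ℝ := ∑ i, (k i : ℝ) ^ 2

/-- The eigenvalue `4π²|k|²` of `-Δ_N` on `e_k`. -/
def symbol {N : ℕ} (k : Fin N → ℤ) : ℝ := 4 * Real.pi ^ 2 * freqSq k

lemma freqSq_nonneg {N : ℕ} (k : Fin N → ℤ) : 0 ≤ freqSq k :=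
  Finset.sum_nonneg fun _ _ => sq_nonneg _

/-- The Sobolev space `H²(𝕋^N) = {ψ ∈ L² : ∑ k, (1 + |k|²)² |ψ̂(k)|² < ∞}`. -/
def H2 (N : ℕ) : Submodule ℂ (L2 N) where
  carrier := {ψ | Summable fun k => (1 + freqSq k) ^ 2 * ‖(expBasis N).repr ψ k‖ ^ 2}
  zero_mem' := by simp [summable_zero]
  add_mem' := by
    intro ψ φ hψ hφ
    refine Summable.of_nonneg_of_le (fun k => by positivity) (fun k => ?_)
      ((hψ.mul_left 2).add (hφ.mul_left 2))
    have h : ‖(expBasis N).repr (ψ + φ) k‖ ≤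
        ‖(expBasis N).repr ψ k‖ + ‖(expBasis N).repr φ k‖ := by
      simpa using norm_add_le ((expBasis N).repr ψ k) ((expBasis N).repr φ k)
    have h2 : ‖(expBasis N).repr (ψ + φ) k‖ ^ 2 ≤
        2 * ‖(expBasis N).repr ψ k‖ ^ 2 + 2 * ‖(expBasis N).repr φ k‖ ^ 2 := by
      nlinarith [norm_nonneg ((expBasis N).repr (ψ + φ) k),
        sq_nonneg (‖(expBasis N).repr ψ k‖ - ‖(expBasis N).repr φ k‖)]
    have := mul_le_mul_of_nonneg_left h2 (sq_nonneg (1 + freqSq k))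
    linarith
  smul_mem' := by
    intro c ψ hψ
    refine (hψ.mul_left (‖c‖ ^ 2)).congr fun k => ?_
    simp [mul_pow]
    ring

lemma memℓp_symbol {N : ℕ} (ψ : H2 N) :
    Memℓp (fun k => (symbol k : ℂ) * (expBasis N).repr (ψ : L2 N) k) 2 := by
  rw [memℓp_gen_iff (by norm_num)]
  have hψ : Summable fun k => (1 + freqSq k) ^ 2 * ‖(expBasis N).repr (ψ : L2 N) k‖ ^ 2 := ψ.2
  refine Summable.of_nonneg_of_le (fun k => by positivity) (fun k => ?_)
    (hψ.mul_left ((4 * Real.pi ^ 2) ^ 2))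
  have h0 := freqSq_nonneg k
  have h1 : freqSq k ^ 2 ≤ (1 + freqSq k) ^ 2 := by nlinarith
  simp only [ENNReal.toReal_ofNat, Real.rpow_ofNat, norm_mul, mul_pow, Complex.norm_real,
    Real.norm_eq_abs, sq_abs, symbol]
  rw [← mul_assoc]
  gcongr

/-- The operator `-Δ_N = -∑ k, Δ_{x_k}` on `L²(𝕋^N)` with domain `H²(𝕋^N)`:
the Fourier coefficients of `-Δ_N ψ` are `4π²|k|² ψ̂(k)`. -/
def negLaplacian (N : ℕ) : L2 N →ₗ.[ℂ] L2 N where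
  domain := H2 N
  toFun :=
    { toFun := fun ψ => (expBasis N).repr.symm ⟨_, memℓp_symbol ψ⟩
      map_add' := by
        intro ψ φ
        rw [← map_add]
        congr 1
        ext k
        change (symbol k : ℂ) * (expBasis N).repr ((ψ : L2 N) + (φ : L2 N)) k =
          (symbol k : ℂ) * (expBasis N).repr (ψ : L2 N) k +
            (symbol k : ℂ) * (expBasis N).repr (φ : L2 N) k
        simp [mul_add]
      map_smul' := by
        intro c ψ
        rw [RingHom.id_apply, ← map_smul]
        congr 1
        ext k
        simp [mul_left_comm] }

/-- The (maximal) operator of multiplication by a real function `W` on `L²(𝕋^N)`,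
with domain `{ψ : W ψ ∈ L²}`. -/
def mulOp {N : ℕ} (W : Config N → ℝ) : L2 N →ₗ.[ℂ] L2 N where
  domain :=
    { carrier := {ψ | MemLp (fun X => (W X : ℂ) * ψ X) 2 (dX N)}
      zero_mem' := by
        refine (memLp_congr_ae ?_).2 (MemLp.zero' (ε := ℂ))
        filter_upwards [Lp.coeFn_zero ℂ 2 (dX N)] with X hX
        rw [hX, Pi.zero_apply, mul_zero]
      add_mem' := by
        intro ψ φ hψ hφ
        refine (memLp_congr_ae ?_).2 (hψ.add hφ)
        filter_upwards [Lp.coeFn_add ψ φ] with X hX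
        rw [hX, Pi.add_apply, Pi.add_apply, mul_add]
      smul_mem' := by
        intro c ψ hψ
        refine (memLp_congr_ae ?_).2 (hψ.const_smul c)
        filter_upwards [Lp.coeFn_smul c ψ] with X hX
        rw [hX, Pi.smul_apply, Pi.smul_apply, smul_eq_mul, smul_eq_mul, mul_left_comm] }
  toFun :=
    { toFun := fun ψ => MemLp.toLp _ ψ.2
      map_add' := by
        intro ψ φ
        rw [← MemLp.toLp_add, MemLp.toLp_eq_toLp_iff]
        filter_upwards [Lp.coeFn_add (ψ : L2 N) (φ : L2 N)] with X hX
        rw [Submodule.coe_add, hX, Pi.add_apply, Pi.add_apply, mul_add]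
      map_smul' := by
        intro c ψ
        rw [RingHom.id_apply, ← MemLp.toLp_const_smul, MemLp.toLp_eq_toLp_iff]
        filter_upwards [Lp.coeFn_smul c (ψ : L2 N)] with X hX
        rw [Submodule.coe_smul, hX, Pi.smul_apply, Pi.smul_apply, smul_eq_mul, smul_eq_mul,
          mul_left_comm] }

/-- The `N`-body Hamiltonian `𝓗_N = -½ ∑ k, Δ_{x_k} + 𝓘_X + 𝓥_X`, where `V X` is the potential of
the configuration `X`; its domain consists of the `ψ ∈ H²(𝕋^N)` with `(𝓘 + 𝓥) ψ ∈ L²`. -/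
def hamiltonian {N : ℕ} (V : Config N → Circ → ℝ) : L2 N →ₗ.[ℂ] L2 N :=
  (1 / 2 : ℂ) • negLaplacian N + mulOp fun X => entropyTerm V X + interactionTerm V X

/-! ### Density operators -/

lemma measurePreserving_perm {N : ℕ} (σ : Equiv.Perm (Fin N)) :
    MeasurePreserving (fun (X : Config N) i => X (σ.symm i)) (dX N) (dX N) := by
  have h := measurePreserving_piCongrLeft (α := fun _ : Fin N => Circ) (fun _ => dx) σ
  convert h using 1
  funext X i
  obtain ⟨j, rfl⟩ := σ.surjective i
  simp [MeasurableEquiv.piCongrLeft, Equiv.piCongrLeft_apply_apply]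

/-- `(U_σ ψ)(x_1, …, x_N) = ψ(x_{σ⁻¹(1)}, …, x_{σ⁻¹(N)})`. -/
def permOp {N : ℕ} (σ : Equiv.Perm (Fin N)) : L2 N →L[ℂ] L2 N :=
  (Lp.compMeasurePreservingₗᵢ ℂ _ (measurePreserving_perm σ)).toContinuousLinearMap

/-- `tr (R) = ∑ k, ⟨e_k, R e_k⟩ ∈ [0, ∞]` of a non-negative bounded operator `R`. -/
def trace {N : ℕ} (R : L2 N →L[ℂ] L2 N) : ℝ≥0∞ :=
  ∑' k, ENNReal.ofReal (inner ℂ (expBasis N k) (R (expBasis N k))).re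

/-- `tr ((-Δ_N)² R) ∈ [0, ∞]` of a non-negative bounded operator `R`, computed in the basis `e_k` of
eigenvectors of `-Δ_N`: `∑ k, ⟨(-Δ_N)² e_k, R e_k⟩` with `(-Δ_N)² e_k = (4π²|k|²)² e_k`. It equals
`‖Δ_N R^{1/2}‖²` in the Hilbert–Schmidt norm. -/
def traceLaplacianSq {N : ℕ} (R : L2 N →L[ℂ] L2 N) : ℝ≥0∞ :=
  ∑' k, ENNReal.ofReal (symbol k ^ 2 * (inner ℂ (expBasis N k) (R (expBasis N k))).re)

/-- Symmetric density operators on `L²(𝕋^N)`: `R = R* ≥ 0`, `tr R = 1` and `U_σ R U_σ* = R` for all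
permutations `σ`. -/
structure IsSymmDensity {N : ℕ} (R : L2 N →L[ℂ] L2 N) : Prop where
  isPositive : R.IsPositive
  trace_eq_one : trace R = 1
  symm : ∀ σ : Equiv.Perm (Fin N),
    permOp σ ∘L R ∘L ContinuousLinearMap.adjoint (permOp σ) = R

/-! ### The von Neumann equation -/

/-- `R` solves `i ∂ₜ R(t) = [H, R(t)]` on the time interval `I`: every `R(t)` is a symmetric density
operator that maps the domain of `H` into itself, and for every `φ` in the domain of `H`,
`t ↦ R(t) φ` is differentiable in `L²` with `∂ₜ R(t) φ = -i (H R(t) φ - R(t) H φ)`. Derivatives at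
end points of `I` are one-sided. -/
def IsSolution {N : ℕ} (H : L2 N →ₗ.[ℂ] L2 N) (I : Set ℝ) (R : ℝ → L2 N →L[ℂ] L2 N) : Prop :=
  ∀ t ∈ I, IsSymmDensity (R t) ∧
    ∀ φ : H.domain, ∃ h : R t φ ∈ H.domain,
      HasDerivWithinAt (fun s => R s φ) ((-Complex.I) • (H ⟨R t φ, h⟩ - R t (H φ))) I t

end VonNeumann

end

/-!
Self-adjointness. In Fourier coefficients the two equations for `X` read
`4π²k² V̂t(k) = μ̂_X(k)` for `k ≠ 0` and `4π²k² V̂h(k) = (1 - exp V)^(k)`. Since `∑ 1 / k²` converges,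
the first one shows that `Vt` depends on `X` continuously in the uniform norm. For the second one,
testing the difference `D` of two solutions with itself and using that `exp` is increasing bounds
`∫ |D'|²` by the variation of `Vt`; so `D` is uniformly close to a constant, and this constant is
small because `exp V` has mass one for every configuration
(`IsPoissonBoltzmann.ae_abs_sub_le`). Hence `𝓘_X + 𝓥_X` is a continuous function on the compact
torus (`continuous_potential`), multiplication by it is a bounded self-adjoint operator, and the
Hamiltonian is a bounded perturbation of `-½ Δ` with the same domain `H²`.

Dynamics. The eigenvalues `2π²|k|²` of `-½ Δ` in the Fourier basis tend to infinity, so the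
Hamiltonian has a compact resolvent, obtained from that of `-½ Δ` by a Neumann series. A Hilbert basis of
eigenvectors of the resolvent diagonalises the Hamiltonian, and `U t = exp (-itH)` is written down
in this basis (`isSelfAdjoint_and_exists_isUnitaryGroup`). An operator commuting with the
Hamiltonian, such as a permutation of the particles, commutes with `U t`.

The von Neumann equation. The solution is `R t = U t ∘ Rin ∘ U (-t)`. The moment condition and the
Cauchy–Schwarz inequality `|⟨e_k, R ψ⟩|² ≤ ⟨e_k, R e_k⟩ ⟨ψ, R ψ⟩` show that `Rin` maps all of `L²`
into `H²`, which is what the product rule for `U t ∘ Rin ∘ U (-t)` needs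
(`IsUnitaryGroup.hasDerivAt_conj`). Conversely, for a solution `S` and `φ ∈ H²` the derivative of
`U (-t) S(t) U(t) φ` vanishes (`IsUnitaryGroup.eq_conj`); here the bound `‖S(t)‖ ≤ tr S(t) = 1` is
used to differentiate the product.
-/

noncomputable section

namespace VonNeumann

open Filter Topology

universe u

/-! ### Diagonal operators and compact operators in a Hilbert basis -/

section HilbertSpace

variable {E : Type u} [NormedAddCommGroup E] [InnerProductSpace ℂ E] {ι : Type*}

lemma hasSum_norm_sq_repr (b : HilbertBasis ι ℂ E) (x : E) :
    HasSum (fun i => ‖b.repr x i‖ ^ 2) (‖x‖ ^ 2) := by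
  have h := (Complex.hasSum_iff _ _).1 (lp.hasSum_inner (b.repr x) (b.repr x))
  have h1 := h.1
  rw [b.repr.inner_map_map, inner_self_eq_norm_sq_to_K] at h1
  convert h1 using 1
  · funext i
    rw [inner_self_eq_norm_sq_to_K]
    norm_cast
  · norm_cast

lemma hilbertBasis_ext (b : HilbertBasis ι ℂ E) {x y : E}
    (h : ∀ i, b.repr x i = b.repr y i) : x = y :=
  b.repr.injective (lp.ext (funext h))

lemma memℓp_mul (b : HilbertBasis ι ℂ E) {m : ι → ℂ} (hm : ∃ C, ∀ i, ‖m i‖ ≤ C) (x : E) :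
    Memℓp (fun i => m i * b.repr x i) 2 := by
  obtain ⟨C, hC⟩ := hm
  rw [memℓp_gen_iff (by norm_num)]
  refine Summable.of_nonneg_of_le (fun i => by positivity) (fun i => ?_)
    ((hasSum_norm_sq_repr b x).summable.mul_left (C ^ 2))
  simp only [ENNReal.toReal_ofNat, Real.rpow_ofNat, norm_mul, mul_pow]
  gcongr
  exact hC i

/-- The bounded operator that is diagonal in the Hilbert basis `b`, with bounded entries `m`. -/
def diagOp (b : HilbertBasis ι ℂ E) (m : ι → ℂ) (hm : ∃ C, ∀ i, ‖m i‖ ≤ C) : E →L[ℂ] E :=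
  LinearMap.mkContinuousOfExistsBound
    { toFun := fun x => b.repr.symm ⟨_, memℓp_mul b hm x⟩
      map_add' := fun x y => hilbertBasis_ext b fun i => by
        simp only [map_add, lp.coeFn_add, Pi.add_apply, LinearIsometryEquiv.apply_symm_apply,
          mul_add]
      map_smul' := fun c x => hilbertBasis_ext b fun i => by simp [mul_left_comm] } <| by
    obtain ⟨C, hC⟩ := hm
    refine ⟨|C|, fun x => abs_le_of_sq_le_sq' ?_ (by positivity) |>.2⟩
    rw [mul_pow]
    refine hasSum_le (fun i => ?_) (hasSum_norm_sq_repr b _)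
      ((hasSum_norm_sq_repr b x).mul_left (|C| ^ 2))
    simp only [LinearMap.coe_mk, AddHom.coe_mk, LinearIsometryEquiv.apply_symm_apply, norm_mul,
      mul_pow]
    gcongr
    exact (hC i).trans (le_abs_self C)

@[simp]
lemma repr_diagOp (b : HilbertBasis ι ℂ E) {m : ι → ℂ} (hm : ∃ C, ∀ i, ‖m i‖ ≤ C) (x : E) (i : ι) :
    b.repr (diagOp b m hm x) i = m i * b.repr x i := by
  simp [diagOp, LinearMap.mkContinuousOfExistsBound]

lemma norm_diagOp_le (b : HilbertBasis ι ℂ E) {m : ι → ℂ} (hm : ∃ C, ∀ i, ‖m i‖ ≤ C) {C : ℝ}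
    (h0 : 0 ≤ C) (hC : ∀ i, ‖m i‖ ≤ C) : ‖diagOp b m hm‖ ≤ C := by
  refine ContinuousLinearMap.opNorm_le_bound _ h0 fun x =>
    abs_le_of_sq_le_sq' ?_ (by positivity) |>.2
  rw [mul_pow]
  refine hasSum_le (fun i => ?_) (hasSum_norm_sq_repr b _)
    ((hasSum_norm_sq_repr b x).mul_left (C ^ 2))
  rw [repr_diagOp, norm_mul, mul_pow]
  gcongr
  exact hC i

/-- A diagonal operator whose entries tend to zero is compact. -/
lemma isCompactOperator_diagOp [CompleteSpace E] (b : HilbertBasis ι ℂ E) {m : ι → ℂ}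
    (hm : ∃ C, ∀ i, ‖m i‖ ≤ C) (h0 : Tendsto m cofinite (𝓝 0)) :
    IsCompactOperator (diagOp b m hm) := by
  classical
  -- The truncations to finite sets of entries have finite rank and converge in operator norm.
  let F : Finset ι → E →L[ℂ] E := fun s =>
    ∑ i ∈ s, (ContinuousLinearMap.toSpanSingleton ℂ (m i • b i)) ∘L innerSL ℂ (b i)
  have hF : ∀ s, IsCompactOperator (F s) := by
    intro s
    have : F s ∈ compactOperator (RingHom.id ℂ) E E := by
      refine Submodule.sum_mem _ fun i _ => ?_
      have h : IsCompactOperator (innerSL ℂ (b i) : E →L[ℂ] ℂ) :=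
        isCompactOperator_of_locallyCompactSpace_dom _
      exact h.clm_comp (ContinuousLinearMap.toSpanSingleton ℂ (m i • b i))
    exact this
  refine isCompactOperator_of_tendsto (l := atTop) (F := F) ?_ (Eventually.of_forall hF)
  rw [Metric.tendsto_atTop]
  intro ε hε
  have hfin : {i | ¬ ‖m i‖ < ε / 2}.Finite := by
    have := h0.norm
    rw [norm_zero] at this
    exact this.eventually (gt_mem_nhds (half_pos hε))
  refine ⟨hfin.toFinset, fun s hs => ?_⟩
  have key : F s - diagOp b m hm = diagOp b (fun i => if i ∈ s then 0 else - m i)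
      ⟨hm.choose, fun i => by
        have := hm.choose_spec i
        split_ifs
        · simpa using (norm_nonneg _).trans this
        · simpa using this⟩ := by
    ext1 x
    refine hilbertBasis_ext b fun j => ?_
    rw [repr_diagOp, sub_apply, map_sub, lp.coeFn_sub, Pi.sub_apply,
      repr_diagOp]
    have : b.repr (F s x) j = if j ∈ s then m j * b.repr x j else 0 := by
      simp only [F, sum_apply, ContinuousLinearMap.comp_apply,
        ContinuousLinearMap.toSpanSingleton_apply, innerSL_apply_apply]
      rw [b.repr_apply_apply, inner_sum]
      simp_rw [inner_smul_right, orthonormal_iff_ite.1 b.orthonormal, ← b.repr_apply_apply]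
      simp [mul_comm]
    rw [this]
    split_ifs <;> ring
  rw [dist_eq_norm, key]
  refine lt_of_le_of_lt (norm_diagOp_le b _ (half_pos hε).le fun i => ?_) (half_lt_self hε)
  split_ifs with hi
  · simpa using (half_pos hε).le
  · rw [norm_neg]
    by_contra hcon
    exact hi (hs (hfin.mem_toFinset.2 fun h => hcon h.le))

/-- The spectral theorem for compact self-adjoint operators, in terms of a Hilbert basis. -/
theorem exists_hilbertBasis_eigenvectors [CompleteSpace E] {T : E →L[ℂ] E}
    (hT : IsCompactOperator T) (hs : T.IsSymmetric) :
    ∃ (κ : Type u) (b : HilbertBasis κ ℂ E) (g : κ → ℝ), ∀ i, T (b i) = (g i : ℂ) • b i := by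
  let V : ℂ → Submodule ℂ E := fun μ => Module.End.eigenspace (T : Module.End ℂ E) μ
  have hcl : ∀ μ, IsClosed (V μ : Set E) := by
    intro μ
    have : (V μ : Set E) = {x | T x = μ • x} := by
      ext x
      simp [V]
    rw [this]
    exact isClosed_eq (by fun_prop) (by fun_prop)
  have : ∀ μ, CompleteSpace (V μ) := fun μ => (hcl μ).completeSpace_coe
  choose w bw hbw using fun μ => exists_hilbertBasis ℂ (V μ)
  let v : (Σ μ, w μ) → E := fun p => ((p.2 : V p.1) : E)
  have hTv : ∀ p, T (v p) = p.1 • v p := fun p =>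
    Module.End.mem_eigenspace_iff.1 (p.2 : V p.1).2
  have hv : Orthonormal ℂ v := by
    have h := hs.orthogonalFamily_eigenspaces.orthonormal_sigma_orthonormal
      (v_family := fun μ (i : w μ) => (i : V μ))
      (fun μ => by
        have := (bw μ).orthonormal
        rwa [hbw μ] at this)
    exact h
  have hspan : (Submodule.span ℂ (range v))ᗮ = ⊥ := by
    rw [eq_bot_iff, ← ContinuousLinearMap.orthogonalComplement_iSup_eigenspaces_eq_bot hT hs]
    intro x hx
    rw [Submodule.mem_orthogonal'] at hx ⊢
    suffices h : ∀ μ, ∀ y ∈ V μ, inner ℂ x y = 0 by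
      intro y hy
      have : (⨆ μ, V μ) ≤ (Submodule.span ℂ {x})ᗮ := iSup_le fun μ z hz => by
        rw [Submodule.mem_orthogonal_singleton_iff_inner_right]
        exact h μ z hz
      exact Submodule.mem_orthogonal_singleton_iff_inner_right.1 (this hy)
    intro μ y hy
    have h1 := ((bw μ).hasSum_repr ⟨y, hy⟩).mapL ((innerSL ℂ x : E →L[ℂ] ℂ) ∘L (V μ).subtypeL)
    refine h1.unique ?_
    have h2 : ∀ i, ((innerSL ℂ x : E →L[ℂ] ℂ) ∘L (V μ).subtypeL)
        ((bw μ).repr ⟨y, hy⟩ i • bw μ i) = 0 := by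
      intro i
      have h3 : inner ℂ x (v ⟨μ, i⟩) = 0 := hx _ (Submodule.subset_span ⟨_, rfl⟩)
      have h4 : ((bw μ i : V μ) : E) = v ⟨μ, i⟩ := by simp [v, hbw μ]
      simp [h4, h3]
    simp only [h2]
    exact hasSum_zero
  let b := HilbertBasis.mkOfOrthogonalEqBot hv hspan
  have hb : ∀ p, b p = v p := fun p => by simp [b]
  refine ⟨(Σ μ, w μ), b, fun p => p.1.re, fun p => ?_⟩
  have hreal : ((p.1.re : ℝ) : ℂ) = p.1 := by
    refine Complex.conj_eq_iff_re.1 (hs.conj_eigenvalue_eq_self ?_)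
    exact Module.End.hasEigenvalue_of_hasEigenvector ⟨(p.2 : V p.1).2, hv.ne_zero p⟩
  rw [hreal, hb, hTv]

/-! ### Unitary groups generated by operators with compact resolvent -/

/-- A symmetric densely defined operator with a surjective real shift is self-adjoint: if `y` is in
the domain of the adjoint and `(H + c) φ = (H* + c) y` with `φ` in the domain of `H`, then `y - φ`
is orthogonal to the range of `H + c`, so `y = φ`. -/
lemma isSelfAdjoint_of_surjective_shift [CompleteSpace E] {H : E →ₗ.[ℂ] E}
    (hd : Dense (H.domain : Set E))
    (hs : ∀ φ ψ : H.domain, inner ℂ (H φ) (ψ : E) = inner ℂ (φ : E) (H ψ))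
    (c : ℝ) (hc : ∀ ψ : E, ∃ φ : H.domain, H φ + (c : ℂ) • (φ : E) = ψ) : IsSelfAdjoint H := by
  rw [LinearPMap.isSelfAdjoint_def]
  have hle : H ≤ H.adjoint := LinearPMap.IsFormalAdjoint.le_adjoint hd fun x y => hs x y
  refine le_antisymm ?_ hle
  have hdom : ∀ y : H.adjoint.domain, (y : E) ∈ H.domain := by
    intro y
    obtain ⟨φ, hφ⟩ := hc (H.adjoint y + (c : ℂ) • (y : E))
    have h0 : (y : E) - φ = 0 := by
      obtain ⟨χ, hχ⟩ := hc ((y : E) - φ)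
      rw [← inner_self_eq_zero (𝕜 := ℂ)]
      nth_rewrite 2 [← hχ]
      have h1 : inner ℂ (H.adjoint y) (χ : E) = inner ℂ (y : E) (H χ) :=
        LinearPMap.adjoint_isFormalAdjoint hd y χ
      have h2 := congrArg (fun z => inner ℂ z (χ : E)) hφ
      simp only [inner_add_left, inner_smul_left, hs, h1, Complex.conj_ofReal] at h2
      simp only [inner_sub_left, inner_add_right, inner_smul_right]
      linear_combination -h2
    rw [sub_eq_zero.1 h0]
    exact φ.2
  exact (LinearPMap.eq_of_le_of_domain_eq hle (le_antisymm hle.1 fun y hy => hdom ⟨y, hy⟩)).ge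

/-- `U` is the unitary group `exp (-itH)` generated by `H`. Besides the group law, unitarity (in the
form `(U t)* = U (-t)`) and the Schrödinger equation for initial data in the domain, this records
that `U t` commutes with `H` and with every bounded operator that commutes with `H`. -/
structure IsUnitaryGroup [CompleteSpace E] (H : E →ₗ.[ℂ] E) (U : ℝ → E →L[ℂ] E) : Prop where
  zero : U 0 = 1
  add : ∀ s t, U (s + t) = U s ∘L U t
  adjoint : ∀ t, ContinuousLinearMap.adjoint (U t) = U (-t)
  comm : ∀ t, ∀ φ : H.domain, ∃ h : U t φ ∈ H.domain, H ⟨U t φ, h⟩ = U t (H φ)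
  hasDerivAt : ∀ t, ∀ φ : H.domain, HasDerivAt (fun s => U s φ) ((-Complex.I) • U t (H φ)) t
  commute : ∀ P : E →L[ℂ] E, (∀ φ : H.domain, ∃ h : P φ ∈ H.domain, H ⟨P φ, h⟩ = P (H φ)) →
    ∀ t, P ∘L U t = U t ∘L P

lemma norm_exp_I_sub_one_sub_le (x : ℝ) : ‖Complex.exp (-(Complex.I * x)) - 1‖ ≤ |x| := by
  have := Real.norm_exp_I_mul_ofReal_sub_one_le (x := -x)
  simpa using this

/-- A symmetric operator with compact resolvent generates a unitary group, which is diagonal in the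
basis of eigenvectors of the resolvent. -/
theorem exists_isUnitaryGroup_of_compact_resolvent [CompleteSpace E] {H : E →ₗ.[ℂ] E}
    (hs : ∀ φ ψ : H.domain, inner ℂ (H φ) (ψ : E) = inner ℂ (φ : E) (H ψ))
    (c : ℝ) (G : E →L[ℂ] E) (hG : IsCompactOperator G)
    (h₁ : ∀ ψ : E, ∃ h : G ψ ∈ H.domain, H ⟨G ψ, h⟩ + (c : ℂ) • G ψ = ψ)
    (h₂ : ∀ φ : H.domain, G (H φ + (c : ℂ) • (φ : E)) = φ) :
    ∃ U : ℝ → E →L[ℂ] E, IsUnitaryGroup H U := by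
  have hGs : G.IsSymmetric := by
    intro x y
    obtain ⟨hx, ex⟩ := h₁ x
    obtain ⟨hy, ey⟩ := h₁ y
    have := hs ⟨G x, hx⟩ ⟨G y, hy⟩
    nth_rewrite 2 [← ex]
    nth_rewrite 1 [← ey]
    simp only [ContinuousLinearMap.coe_coe, inner_add_left, inner_add_right, inner_smul_left,
      inner_smul_right, Complex.conj_ofReal] at this ⊢
    rw [this]
  obtain ⟨κ, b, g, hg⟩ := exists_hilbertBasis_eigenvectors hG hGs
  have hg0 : ∀ i, g i ≠ 0 := by
    intro i h0
    obtain ⟨h, e⟩ := h₁ (b i)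
    have hz : G (b i) = 0 := by rw [hg, h0]; simp
    have : H ⟨G (b i), h⟩ = 0 := by
      have : (⟨G (b i), h⟩ : H.domain) = 0 := Subtype.ext hz
      rw [this, H.map_zero]
    rw [this, hz] at e
    exact b.orthonormal.ne_zero i (by simpa using e.symm)
  have hGr : ∀ x i, b.repr (G x) i = (g i : ℂ) * b.repr x i := by
    intro x i
    rw [b.repr_apply_apply, b.repr_apply_apply]
    have := hGs (b i) x
    simp only [ContinuousLinearMap.coe_coe] at this
    rw [← this, hg, inner_smul_left, Complex.conj_ofReal]
  -- The eigenvalues of `H`.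
  let l : κ → ℝ := fun i => (g i)⁻¹ - c
  have hHr : ∀ (φ : H.domain) i, b.repr (H φ) i = (l i : ℂ) * b.repr (φ : E) i := by
    intro φ i
    have h := hGr (H φ + (c : ℂ) • (φ : E)) i
    rw [h₂, map_add, map_smul, lp.coeFn_add, Pi.add_apply, lp.coeFn_smul, Pi.smul_apply,
      smul_eq_mul] at h
    have : (g i : ℂ) ≠ 0 := by exact_mod_cast hg0 i
    have h' := (inv_mul_eq_iff_eq_mul₀ this).2 h
    simp only [l]
    push_cast
    linear_combination -h'
  have hbd : ∀ t : ℝ, ∃ C : ℝ, ∀ i, ‖Complex.exp (-(Complex.I * ((t * l i : ℝ) : ℂ)))‖ ≤ C :=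
    fun t => ⟨1, fun i => by
      rw [← mul_neg, ← Complex.ofReal_neg, mul_comm, Complex.norm_exp_ofReal_mul_I]⟩
  let U : ℝ → E →L[ℂ] E := fun t => diagOp b _ (hbd t)
  have hU : ∀ t x i, b.repr (U t x) i =
      Complex.exp (-(Complex.I * ((t * l i : ℝ) : ℂ))) * b.repr x i :=
    fun t x i => repr_diagOp b (hbd t) x i
  have hadd : ∀ s t, U (s + t) = U s ∘L U t := fun s t => by
    ext1 x
    refine hilbertBasis_ext b fun i => ?_
    rw [ContinuousLinearMap.comp_apply, hU, hU, hU, ← mul_assoc, ← Complex.exp_add]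
    congr 2
    push_cast
    ring
  have hcommG : ∀ P : E →L[ℂ] E, P ∘L G = G ∘L P → ∀ t, P ∘L U t = U t ∘L P := by
    intro P hP t
    -- Matrix entries of `P` between different eigenspaces of `G` vanish.
    have hP0 : ∀ i j, inner ℂ (b i) (P (b j)) = 0 ∨ l i = l j := by
      intro i j
      have h1 := hGs (b i) (P (b j))
      have h2 : G (P (b j)) = P (G (b j)) := (congrArg (fun T : E →L[ℂ] E => T (b j)) hP).symm
      simp only [ContinuousLinearMap.coe_coe] at h1
      rw [h2, hg, hg, map_smul, inner_smul_left, inner_smul_right, Complex.conj_ofReal] at h1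
      rcases mul_eq_mul_right_iff.1 h1 with h | h
      · exact Or.inr (by simp only [l]; rw [Complex.ofReal_inj.1 h])
      · exact Or.inl h
    ext1 x
    refine hilbertBasis_ext b fun i => ?_
    rw [ContinuousLinearMap.comp_apply, ContinuousLinearMap.comp_apply, hU, b.repr_apply_apply,
      b.repr_apply_apply, ← ContinuousLinearMap.adjoint_inner_left P (U t x),
      ← ContinuousLinearMap.adjoint_inner_left P x]
    refine (b.hasSum_inner_mul_inner _ (U t x)).unique ?_
    refine ((b.hasSum_inner_mul_inner (ContinuousLinearMap.adjoint P (b i)) x).mul_left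
      (Complex.exp (-(Complex.I * ((t * l i : ℝ) : ℂ))))).congr_fun fun j => ?_
    rw [← b.repr_apply_apply, hU, b.repr_apply_apply, ContinuousLinearMap.adjoint_inner_left]
    rcases hP0 i j with h | h
    · simp [h]
    · rw [h]
      ring
  have hUG : ∀ t x, U t (G x) = G (U t x) := fun t x =>
    hilbertBasis_ext b fun i => by rw [hU, hGr, hGr, hU]; ring
  have hcomm : ∀ t, ∀ φ : H.domain, ∃ h : U t φ ∈ H.domain, H ⟨U t φ, h⟩ = U t (H φ) := by
    intro t φ
    have hmem : U t φ ∈ H.domain := by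
      rw [← h₂ φ, hUG]
      exact (h₁ _).1
    refine ⟨hmem, hilbertBasis_ext b fun i => ?_⟩
    rw [hHr, hU, hU, hHr]
    ring
  have hzero : U 0 = 1 := by
    ext1 x
    exact hilbertBasis_ext b fun i => by rw [hU]; simp
  have hderiv : ∀ φ : H.domain, HasDerivAt (fun s => U s φ) ((-Complex.I) • H φ) 0 := by
    intro φ
    rw [hasDerivAt_iff_tendsto_slope_zero, tendsto_iff_norm_sub_tendsto_zero]
    -- The coordinates of the remainder, and its squared norm as a sum over the eigenbasis.
    have hr : ∀ (h : ℝ) i, b.repr (h⁻¹ • (U (0 + h) φ - U 0 φ) - (-Complex.I) • H φ) i =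
        ((h : ℂ)⁻¹ * (Complex.exp (-(Complex.I * ((h * l i : ℝ) : ℂ))) - 1) + Complex.I * l i) *
          b.repr (φ : E) i := by
      intro h i
      have : h⁻¹ • (U (0 + h) φ - U 0 φ) = (h : ℂ)⁻¹ • (U (0 + h) φ - U 0 φ) := by
        rw [← Complex.ofReal_inv, Complex.coe_smul]
      rw [this, map_sub, map_smul, map_smul, map_sub]
      simp only [lp.coeFn_sub, Pi.sub_apply, lp.coeFn_smul, Pi.smul_apply, smul_eq_mul, hU, hHr,
        zero_add]
      simp
      ring
    suffices hsq : Tendsto (fun h : ℝ =>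
        ‖h⁻¹ • (U (0 + h) φ - U 0 φ) - (-Complex.I) • H φ‖ ^ 2) (𝓝[≠] 0) (𝓝 0) by
      simpa using hsq.sqrt
    have hsum := fun h : ℝ => (hasSum_norm_sq_repr b
      (h⁻¹ • (U (0 + h) φ - U 0 φ) - (-Complex.I) • H φ)).tsum_eq
    simp only [← hsum, hr]
    rw [show 𝓝 (0 : ℝ) = 𝓝 (∑' _ : κ, (0 : ℝ)) by rw [tsum_zero]]
    refine tendsto_tsum_of_dominated_convergence
      ((hasSum_norm_sq_repr b (H φ)).summable.mul_left 4) (fun i => ?_) ?_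
    · have hd : HasDerivAt (fun h : ℝ => Complex.exp (-(Complex.I * ((h * l i : ℝ) : ℂ))))
          (-(Complex.I * l i)) 0 := by
        have h1 : HasDerivAt (fun h : ℝ => -(Complex.I * ((h * l i : ℝ) : ℂ)))
            (-(Complex.I * l i)) 0 := by
          have := (((hasDerivAt_id (0 : ℝ)).mul_const (l i)).ofReal_comp.const_mul Complex.I).fun_neg
          simpa using this
        simpa using h1.cexp
      have h2 := hd.tendsto_slope_zero
      simp only [zero_add, zero_mul, Complex.ofReal_zero, mul_zero, neg_zero, Complex.exp_zero,
        Complex.real_smul, Complex.ofReal_inv] at h2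
      have h3 := ((h2.add_const (Complex.I * l i)).mul_const (b.repr (φ : E) i)).norm.pow 2
      simpa using h3
    · filter_upwards [self_mem_nhdsWithin] with h hh i
      have hh' : 0 < |h| := abs_pos.2 hh
      rw [norm_pow, norm_norm, hHr, norm_mul, norm_mul, mul_pow, mul_pow, ← mul_assoc]
      gcongr
      rw [show (4 : ℝ) * ‖(l i : ℂ)‖ ^ 2 = (|l i| + |l i|) ^ 2 by
        rw [Complex.norm_real, Real.norm_eq_abs]; ring]
      gcongr
      refine (norm_add_le _ _).trans (add_le_add ?_ (by simp))
      rw [norm_mul, norm_inv, Complex.norm_real, Real.norm_eq_abs, inv_mul_le_iff₀ hh', ← abs_mul]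
      exact norm_exp_I_sub_one_sub_le _
  refine ⟨U, ?_, hadd, ?_, hcomm, ?_, ?_⟩
  · exact hzero
  · intro t
    refine (ContinuousLinearMap.eq_adjoint_iff _ _).2 ?_ |>.symm
    intro x y
    rw [← b.repr.inner_map_map, ← b.repr.inner_map_map, lp.inner_eq_tsum, lp.inner_eq_tsum]
    refine tsum_congr fun i => ?_
    rw [hU, hU]
    simp only [RCLike.inner_apply, map_mul, ← Complex.exp_conj]
    simp
    ring_nf
  · intro t φ
    have h0 : HasDerivAt (fun s => U s φ) ((-Complex.I) • H φ) (t - t) := by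
      rw [sub_self]
      exact hderiv φ
    have h1 := ((U t).restrictScalars ℝ).hasFDerivAt.comp_hasDerivAt t (h0.comp_sub_const t t)
    rw [ContinuousLinearMap.coe_restrictScalars', map_smul] at h1
    refine h1.congr_of_eventuallyEq (Eventually.of_forall fun s => ?_)
    change U s φ = U t (U (s - t) φ)
    rw [← ContinuousLinearMap.comp_apply, ← hadd, add_sub_cancel]
  · intro P hP t
    refine hcommG P ?_ t
    ext1 x
    obtain ⟨h, e⟩ := h₁ x
    obtain ⟨h', e'⟩ := hP ⟨G x, h⟩
    have := h₂ ⟨P (G x), h'⟩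
    simp only at this e'
    rw [e', ← map_smul, ← map_add, e] at this
    simpa using this.symm

/-- The Kato–Rellich theorem for a bounded perturbation `B` of a diagonal operator with nonnegative
entries `a` tending to infinity, together with the unitary group of the sum `H`. -/
theorem isSelfAdjoint_and_exists_isUnitaryGroup [CompleteSpace E] (b : HilbertBasis ι ℂ E)
    {a : ι → ℝ} (ha0 : ∀ i, 0 ≤ a i) (ha : Tendsto a cofinite atTop) {B : E →L[ℂ] E}
    (hB : IsSelfAdjoint B) {H : E →ₗ.[ℂ] E}
    (hdom : ∀ x, x ∈ H.domain ↔ Summable fun i => a i ^ 2 * ‖b.repr x i‖ ^ 2)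
    (hH : ∀ (φ : H.domain) i, b.repr (H φ) i = (a i : ℂ) * b.repr (φ : E) i + b.repr (B φ) i) :
    IsSelfAdjoint H ∧ ∃ U : ℝ → E →L[ℂ] E, IsUnitaryGroup H U := by
  classical
  have hs : ∀ φ ψ : H.domain, inner ℂ (H φ) (ψ : E) = inner ℂ (φ : E) (H ψ) := by
    intro φ ψ
    have h1 : inner ℂ (H φ - B φ) (ψ : E) = inner ℂ (φ : E) (H ψ - B ψ) := by
      rw [← b.repr.inner_map_map, ← b.repr.inner_map_map, lp.inner_eq_tsum, lp.inner_eq_tsum]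
      refine tsum_congr fun i => ?_
      rw [map_sub, map_sub, lp.coeFn_sub, lp.coeFn_sub, Pi.sub_apply, Pi.sub_apply, hH, hH]
      simp
      ring
    have h2 : inner ℂ (B φ) (ψ : E) = inner ℂ (φ : E) (B ψ) := hB.isSymmetric φ ψ
    rw [inner_sub_left, inner_sub_right, h2] at h1
    exact sub_left_inj.1 h1
  have hd : Dense (H.domain : Set E) := by
    have hle : Submodule.span ℂ (range b) ≤ H.domain := by
      rw [Submodule.span_le]
      rintro _ ⟨i, rfl⟩
      refine (hdom _).2 (summable_of_ne_finset_zero (s := {i}) fun j hj => ?_)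
      rw [b.repr_self, lp.single_apply_ne _ _ _ (by simpa using hj)]
      simp
    have := b.dense_span
    rw [← Submodule.dense_iff_topologicalClosure_eq_top] at this
    exact this.mono hle
  -- For this shift the resolvent `T = (D + c)⁻¹` of the diagonal part satisfies `‖B‖ ‖T‖ < 1`.
  let c : ℝ := ‖B‖ + 1
  have hc : 0 < c := by positivity
  have hac : ∀ i, c ≤ a i + c := fun i => by linarith [ha0 i]
  have hac0 : ∀ i, 0 < a i + c := fun i => hc.trans_le (hac i)
  have hbd : ∀ i, ‖(((a i + c)⁻¹ : ℝ) : ℂ)‖ ≤ c⁻¹ := fun i => by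
    rw [Complex.norm_real, Real.norm_eq_abs, abs_of_pos (inv_pos.2 (hac0 i))]
    exact inv_anti₀ hc (hac i)
  let T : E →L[ℂ] E := diagOp b (fun i => (((a i + c)⁻¹ : ℝ) : ℂ)) ⟨_, hbd⟩
  have hTr : ∀ x i, b.repr (T x) i = (((a i + c)⁻¹ : ℝ) : ℂ) * b.repr x i := fun x i =>
    repr_diagOp b _ x i
  have hTn : ‖T‖ ≤ c⁻¹ := norm_diagOp_le b _ (inv_pos.2 hc).le hbd
  have hTc : IsCompactOperator T := by
    refine isCompactOperator_diagOp b _ ?_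
    have h1 : Tendsto (fun i => (a i + c)⁻¹) cofinite (𝓝 0) :=
      tendsto_inv_atTop_zero.comp (tendsto_atTop_add_const_right _ c ha)
    have := (Complex.continuous_ofReal.tendsto 0).comp h1
    rwa [Complex.ofReal_zero] at this
  have hBT : ‖B‖ * ‖T‖ < 1 := by
    calc ‖B‖ * ‖T‖ ≤ ‖B‖ * c⁻¹ := by gcongr
      _ < 1 := by
        rw [← div_eq_mul_inv, div_lt_one hc]
        exact lt_add_one _
  have hTdom : ∀ x, T x ∈ H.domain := by
    intro x
    refine (hdom _).2 (Summable.of_nonneg_of_le (fun i => by positivity) (fun i => ?_)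
      (hasSum_norm_sq_repr b x).summable)
    rw [hTr, norm_mul, mul_pow, ← mul_assoc, Complex.norm_real, Real.norm_eq_abs, sq_abs,
      ← mul_pow]
    refine mul_le_of_le_one_left (by positivity) (pow_le_one₀ ?_ ?_)
    · exact mul_nonneg (ha0 i) (inv_pos.2 (hac0 i)).le
    · rw [← div_eq_mul_inv, div_le_one (hac0 i)]
      linarith
  have hHT : ∀ x, H ⟨T x, hTdom x⟩ + (c : ℂ) • T x = x + B (T x) := by
    intro x
    refine hilbertBasis_ext b fun i => ?_
    rw [map_add, map_add, map_smul, lp.coeFn_add, lp.coeFn_add, lp.coeFn_smul, Pi.add_apply,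
      Pi.add_apply, Pi.smul_apply, hH, hTr, smul_eq_mul]
    have : ((a i : ℂ) + c) ≠ 0 := by exact_mod_cast (hac0 i).ne'
    push_cast
    field_simp
    ring
  -- Invert `1 + B T` by a Neumann series.
  have hlt : ‖-(B ∘L T)‖ < 1 := by
    rw [norm_neg]
    exact (ContinuousLinearMap.opNorm_comp_le _ _).trans_lt hBT
  let u : (E →L[ℂ] E)ˣ := Units.oneSub _ hlt
  let S : E →L[ℂ] E := ↑u⁻¹
  have hS : ∀ x, S x + B (T (S x)) = x := by
    intro x
    have h1 : (u : E →L[ℂ] E) * S = 1 := u.mul_inv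
    have h2 := congrArg (fun A : E →L[ℂ] E => A x) h1
    simpa [u] using h2
  have h₁ : ∀ ψ : E, ∃ h : (T ∘L S) ψ ∈ H.domain,
      H ⟨(T ∘L S) ψ, h⟩ + (c : ℂ) • (T ∘L S) ψ = ψ := by
    intro ψ
    refine ⟨hTdom _, ?_⟩
    exact (hHT (S ψ)).trans (hS ψ)
  -- `H + c` is injective because `(H + c) d = 0` means `d = -T B d`, and `‖T B‖ < 1`.
  have hinj : ∀ d : H.domain, H d + (c : ℂ) • (d : E) = 0 → d = 0 := by
    intro d hd0
    have h1 : (d : E) = -T (B d) := by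
      refine hilbertBasis_ext b fun i => ?_
      have h2 := congrArg (fun x => b.repr x i) hd0
      simp only [map_add, map_smul, lp.coeFn_add, Pi.add_apply, lp.coeFn_smul, Pi.smul_apply,
        smul_eq_mul, hH, map_zero, lp.coeFn_zero, Pi.zero_apply] at h2
      rw [map_neg, lp.coeFn_neg, Pi.neg_apply, hTr]
      have : ((a i : ℂ) + c) ≠ 0 := by exact_mod_cast (hac0 i).ne'
      push_cast
      field_simp
      linear_combination h2
    have h2 : ‖(d : E)‖ ≤ (‖B‖ * ‖T‖) * ‖(d : E)‖ := by
      nth_rewrite 1 [h1]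
      rw [norm_neg, mul_comm ‖B‖, mul_assoc]
      exact (T.le_opNorm _).trans (by gcongr; exact B.le_opNorm _)
    have h3 : ‖(d : E)‖ = 0 := by nlinarith [norm_nonneg (d : E)]
    exact Subtype.ext (norm_eq_zero.1 h3)
  have h₂ : ∀ φ : H.domain, (T ∘L S) (H φ + (c : ℂ) • (φ : E)) = φ := by
    intro φ
    obtain ⟨h, e⟩ := h₁ (H φ + (c : ℂ) • (φ : E))
    have := hinj (⟨_, h⟩ - φ) (by
      rw [H.map_sub, Submodule.coe_sub, smul_sub]
      rw [← sub_eq_zero] at e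
      rw [← e]
      abel)
    exact congrArg Subtype.val (sub_eq_zero.1 this)
  refine ⟨isSelfAdjoint_of_surjective_shift hd hs c fun ψ => ?_,
    exists_isUnitaryGroup_of_compact_resolvent hs c (T ∘L S) (hTc.comp_clm S) h₁ h₂⟩
  obtain ⟨h, e⟩ := h₁ ψ
  exact ⟨⟨_, h⟩, e⟩

/-! ### The von Neumann equation and the trace -/

/-- Pointwise convergence of contractions extends from a dense set to the whole space. -/
lemma tendsto_apply_of_dense {α : Type*} {l : Filter α} {A : α → E →L[ℂ] E} {A₀ : E →L[ℂ] E}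
    (hA : ∀ᶠ s in l, ‖A s‖ ≤ 1) (hA₀ : ‖A₀‖ ≤ 1) {D : Set E} (hD : Dense D)
    (h : ∀ x ∈ D, Tendsto (fun s => A s x) l (𝓝 (A₀ x))) (x : E) :
    Tendsto (fun s => A s x) l (𝓝 (A₀ x)) := by
  rw [Metric.tendsto_nhds]
  intro ε hε
  obtain ⟨y, hy, hxy⟩ := hD.exists_dist_lt x (show 0 < ε / 3 by positivity)
  have hcontr : ∀ T : E →L[ℂ] E, ‖T‖ ≤ 1 → dist (T x) (T y) ≤ dist x y := fun T hT => by
    rw [dist_eq_norm, dist_eq_norm, ← map_sub]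
    exact (T.le_opNorm _).trans (mul_le_of_le_one_left (norm_nonneg _) hT)
  filter_upwards [hA, Metric.tendsto_nhds.1 (h y hy) (ε / 3) (by positivity)] with s hs hs'
  have h1 := hcontr _ hs
  have h2 := hcontr _ hA₀
  have h3 := dist_triangle4 (A s x) (A s y) (A₀ y) (A₀ x)
  rw [dist_comm (A₀ y)] at h3
  linarith

/-- The product rule for `s ↦ A s (y s)` when `A` is a family of contractions that is only
strongly differentiable at the vector `y t`. -/
lemma hasDerivWithinAt_apply {A : ℝ → E →L[ℂ] E} {I : Set ℝ} {t : ℝ} {y : ℝ → E} {y' z : E}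
    (hA : ∀ s ∈ I, ‖A s‖ ≤ 1) (hc : Tendsto (fun s => A s y') (𝓝[I] t) (𝓝 (A t y')))
    (hy : HasDerivWithinAt y y' I t) (hz : HasDerivWithinAt (fun s => A s (y t)) z I t) :
    HasDerivWithinAt (fun s => A s (y s)) (A t y' + z) I t := by
  rw [hasDerivWithinAt_iff_isLittleO] at hy hz ⊢
  have h2 : (fun s => A s (y s - y t - (s - t) • y')) =o[𝓝[I] t] fun s => s - t := by
    refine Asymptotics.IsBigO.trans_isLittleO (Asymptotics.IsBigO.of_bound 1 ?_) hy
    filter_upwards [self_mem_nhdsWithin] with s hs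
    exact ((A s).le_opNorm _).trans (mul_le_mul_of_nonneg_right (hA s hs) (norm_nonneg _))
  have h3 : (fun s => (s - t) • (A s y' - A t y')) =o[𝓝[I] t] fun s => s - t := by
    have h4 : (fun s => A s y' - A t y') =o[𝓝[I] t] fun _ => (1 : ℝ) := by
      rw [Asymptotics.isLittleO_one_iff]
      simpa using hc.sub_const (A t y')
    simpa using (Asymptotics.isBigO_refl (fun s : ℝ => s - t) (𝓝[I] t)).smul_isLittleO h4
  -- `A s (y s) - A t (y t)` splits into the increments of `A · (y t)`, of `y`, and of `A · y'`.
  refine ((hz.add h2).add h3).congr_left fun s => ?_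
  have : A s ((s - t) • y') = (s - t) • A s y' := (A s).map_smul_of_tower _ _
  rw [map_sub, map_sub, this]
  module

namespace IsUnitaryGroup
variable [CompleteSpace E] {H : E →ₗ.[ℂ] E} {U : ℝ → E →L[ℂ] E}

lemma neg_apply_apply (hU : IsUnitaryGroup H U) (t : ℝ) (x : E) : U (-t) (U t x) = x := by
  rw [← ContinuousLinearMap.comp_apply, ← hU.add, neg_add_cancel, hU.zero]
  rfl

lemma apply_neg_apply (hU : IsUnitaryGroup H U) (t : ℝ) (x : E) : U t (U (-t) x) = x := by
  simpa using hU.neg_apply_apply (-t) x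

lemma norm_le_one (hU : IsUnitaryGroup H U) (t : ℝ) : ‖U t‖ ≤ 1 := by
  refine ContinuousLinearMap.opNorm_le_bound _ zero_le_one fun x => ?_
  have h : inner ℂ (U t x) (U t x) = inner ℂ x x := by
    rw [← ContinuousLinearMap.adjoint_inner_left, hU.adjoint, hU.neg_apply_apply]
  rw [one_mul, norm_eq_sqrt_re_inner (𝕜 := ℂ), h, ← norm_eq_sqrt_re_inner (𝕜 := ℂ)]

lemma tendsto (hU : IsUnitaryGroup H U) (hd : Dense (H.domain : Set E)) (t : ℝ) (x : E) :
    Tendsto (fun s => U s x) (𝓝 t) (𝓝 (U t x)) :=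
  tendsto_apply_of_dense (Eventually.of_forall hU.norm_le_one) (hU.norm_le_one t) hd
    (fun y hy => (hU.hasDerivAt t ⟨y, hy⟩).continuousAt) x

lemma hasDerivAt_neg (hU : IsUnitaryGroup H U) (t : ℝ) (φ : H.domain) :
    HasDerivAt (fun s => U (-s) φ) (Complex.I • U (-t) (H φ)) t := by
  have := (hU.hasDerivAt (-t) φ).scomp t (_root_.hasDerivAt_neg t)
  simpa [Function.comp_def] using this

/-- Conjugation by the unitary group solves the von Neumann equation, as soon as the initial
operator maps into the domain. -/
theorem hasDerivAt_conj (hU : IsUnitaryGroup H U) (hd : Dense (H.domain : Set E)) {R : E →L[ℂ] E}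
    (hR : ∀ x, R x ∈ H.domain) (t : ℝ) (φ : H.domain) :
    ∃ h : (U t ∘L R ∘L U (-t)) φ ∈ H.domain,
      HasDerivAt (fun s => (U s ∘L R ∘L U (-s)) φ)
        ((-Complex.I) • (H ⟨(U t ∘L R ∘L U (-t)) φ, h⟩ - (U t ∘L R ∘L U (-t)) (H φ))) t := by
  obtain ⟨h, e⟩ := hU.comm t ⟨R (U (-t) φ), hR _⟩
  refine ⟨h, ?_⟩
  have hy : HasDerivAt (fun s => R (U (-s) φ)) (R (Complex.I • U (-t) (H φ))) t :=
    (R.restrictScalars ℝ).hasFDerivAt.comp_hasDerivAt t (hU.hasDerivAt_neg t φ)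
  have hz := hU.hasDerivAt t ⟨R (U (-t) φ), hR _⟩
  have := hasDerivWithinAt_apply (I := univ) (fun s _ => hU.norm_le_one s)
    ((hU.tendsto hd t _).mono_left nhdsWithin_le_nhds) hy.hasDerivWithinAt hz.hasDerivWithinAt
  rw [hasDerivWithinAt_univ] at this
  refine this.congr_deriv ?_
  have e' : H ⟨(U t ∘L R ∘L U (-t)) φ, h⟩ = U t (H ⟨R (U (-t) φ), hR _⟩) := e
  rw [e', map_smul, map_smul, smul_sub]
  simp only [ContinuousLinearMap.comp_apply]
  module

/-- Solutions of the von Neumann equation in contractions are conjugations by the unitary group. -/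
theorem eq_conj (hU : IsUnitaryGroup H U) (hd : Dense (H.domain : Set E)) {T : ℝ}
    {S : ℝ → E →L[ℂ] E} (hS1 : ∀ t ∈ Icc 0 T, ‖S t‖ ≤ 1)
    (hS : ∀ t ∈ Icc 0 T, ∀ φ : H.domain, ∃ h : S t φ ∈ H.domain,
      HasDerivWithinAt (fun s => S s φ) ((-Complex.I) • (H ⟨S t φ, h⟩ - S t (H φ))) (Icc 0 T) t)
    {t : ℝ} (ht : t ∈ Icc 0 T) : S t = U t ∘L S 0 ∘L U (-t) := by
  have key : ∀ φ : H.domain, S t (U t φ) = U t (S 0 φ) := by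
    intro φ
    -- `w s = S s (U s φ)` solves the Schrödinger equation, so `U (-s) (w s)` is constant.
    have hder : ∀ r ∈ Icc 0 T,
        HasDerivWithinAt (fun s => U (-s) (S s (U s φ))) 0 (Icc 0 T) r := by
      intro r hr
      obtain ⟨h1, e1⟩ := hU.comm r φ
      obtain ⟨h2, hS2⟩ := hS r hr ⟨_, h1⟩
      have hw := hasDerivWithinAt_apply hS1
        (tendsto_apply_of_dense (eventually_nhdsWithin_of_forall hS1) (hS1 r hr) hd
          (fun y hy => (hS r hr ⟨y, hy⟩).choose_spec.continuousWithinAt) _)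
        (hU.hasDerivAt r φ).hasDerivWithinAt hS2
      have hw' : HasDerivWithinAt (fun s => S s (U s φ)) ((-Complex.I) • H ⟨_, h2⟩)
          (Icc 0 T) r := by
        convert hw using 1
        rw [e1, map_smul, smul_sub]
        abel
      have hfin := hasDerivWithinAt_apply (A := fun s => U (-s)) (I := Icc 0 T) (t := r)
        (fun s _ => hU.norm_le_one (-s))
        (((hU.tendsto hd (-r) _).comp (continuous_neg.tendsto r)).mono_left nhdsWithin_le_nhds)
        hw' (hU.hasDerivAt_neg r ⟨_, h2⟩).hasDerivWithinAt
      convert hfin using 1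
      rw [map_smul]
      module
    have hT : 0 ≤ T := ht.1.trans ht.2
    have hconst := constant_of_derivWithin_zero
      (fun r hr => (hder r hr).differentiableWithinAt)
      (fun r hr => by
        have hr' := Ico_subset_Icc_self hr
        exact (hder r hr').derivWithin
          (uniqueDiffOn_Icc (hr.1.trans_lt hr.2) r hr')) t ht
    simp only [neg_zero, hU.zero, one_apply_eq_self] at hconst
    rw [← hconst, hU.apply_neg_apply]
  have key' : ∀ x, S t (U t x) = U t (S 0 x) := fun x =>
    congrFun (Continuous.ext_on hd (by fun_prop) (by fun_prop) fun y hy => key ⟨y, hy⟩ :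
      (fun x => S t (U t x)) = fun x => U t (S 0 x)) x
  ext1 x
  have := key' (U (-t) x)
  rwa [hU.apply_neg_apply] at this

end IsUnitaryGroup

/-- Parseval's identity in `[0, ∞]`. -/
lemma ofReal_norm_sq_eq_tsum (b : HilbertBasis ι ℂ E) (x : E) :
    ENNReal.ofReal (‖x‖ ^ 2) = ∑' i, ENNReal.ofReal (‖inner ℂ (b i) x‖ ^ 2) := by
  simp_rw [← b.repr_apply_apply]
  rw [← (hasSum_norm_sq_repr b x).tsum_eq]
  exact ENNReal.ofReal_tsum_of_nonneg (fun _ => by positivity) (hasSum_norm_sq_repr b x).summable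

/-- `tr (S* S) = tr (S S*)`, even when computed in different bases. -/
lemma tsum_norm_sq_apply_eq_adjoint [CompleteSpace E] {κ : Type*} (b : HilbertBasis ι ℂ E)
    (b' : HilbertBasis κ ℂ E) (S : E →L[ℂ] E) :
    ∑' i, ENNReal.ofReal (‖S (b i)‖ ^ 2) =
      ∑' j, ENNReal.ofReal (‖ContinuousLinearMap.adjoint S (b' j)‖ ^ 2) := by
  simp_rw [fun i => ofReal_norm_sq_eq_tsum b' (S (b i)),
    fun j => ofReal_norm_sq_eq_tsum b (ContinuousLinearMap.adjoint S (b' j))]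
  rw [ENNReal.tsum_comm]
  refine tsum_congr fun j => tsum_congr fun i => ?_
  rw [← ContinuousLinearMap.adjoint_inner_left,
    ← inner_conj_symm, RCLike.norm_conj]

lemma exists_eq_adjoint_comp_self [CompleteSpace E] {R : E →L[ℂ] E} (hR : R.IsPositive) :
    ∃ S : E →L[ℂ] E, R = ContinuousLinearMap.adjoint S ∘L S := by
  obtain ⟨S, hS⟩ := CStarAlgebra.nonneg_iff_eq_star_mul_self.1
    ((ContinuousLinearMap.nonneg_iff_isPositive R).2 hR)
  exact ⟨S, hS⟩

lemma inner_adjoint_comp_self_re [CompleteSpace E] (S : E →L[ℂ] E) (x : E) :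
    (inner ℂ x ((ContinuousLinearMap.adjoint S ∘L S) x)).re = ‖S x‖ ^ 2 := by
  rw [ContinuousLinearMap.comp_apply, ContinuousLinearMap.adjoint_inner_right]
  exact inner_self_eq_norm_sq (𝕜 := ℂ) (S x)

/-- The Cauchy–Schwarz inequality for the form of a positive operator. -/
lemma norm_inner_apply_sq_le [CompleteSpace E] {R : E →L[ℂ] E} (hR : R.IsPositive) (x y : E) :
    ‖inner ℂ x (R y)‖ ^ 2 ≤ (inner ℂ x (R x)).re * (inner ℂ y (R y)).re := by
  obtain ⟨S, rfl⟩ := exists_eq_adjoint_comp_self hR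
  rw [inner_adjoint_comp_self_re, inner_adjoint_comp_self_re, ContinuousLinearMap.comp_apply,
    ContinuousLinearMap.adjoint_inner_right, ← mul_pow]
  gcongr
  exact norm_inner_le_norm _ _

/-- The trace of a positive operator is invariant under unitary conjugation. -/
lemma tsum_inner_conj_eq [CompleteSpace E] (b : HilbertBasis ι ℂ E) {R W : E →L[ℂ] E}
    (hR : R.IsPositive) (hW : ContinuousLinearMap.adjoint W ∘L W = 1) :
    ∑' i, ENNReal.ofReal (inner ℂ (b i) ((W ∘L R ∘L ContinuousLinearMap.adjoint W) (b i))).re =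
      ∑' i, ENNReal.ofReal (inner ℂ (b i) (R (b i))).re := by
  obtain ⟨S, rfl⟩ := exists_eq_adjoint_comp_self hR
  have h1 : W ∘L (ContinuousLinearMap.adjoint S ∘L S) ∘L ContinuousLinearMap.adjoint W =
      ContinuousLinearMap.adjoint (S ∘L ContinuousLinearMap.adjoint W) ∘L
        (S ∘L ContinuousLinearMap.adjoint W) := by
    rw [ContinuousLinearMap.adjoint_comp, ContinuousLinearMap.adjoint_adjoint]
    rfl
  simp_rw [h1, inner_adjoint_comp_self_re]
  rw [tsum_norm_sq_apply_eq_adjoint b b, tsum_norm_sq_apply_eq_adjoint b b S]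
  refine tsum_congr fun i => ?_
  -- `‖W S* b‖ = ‖S* b‖` because `W` is an isometry.
  rw [ContinuousLinearMap.adjoint_comp, ContinuousLinearMap.adjoint_adjoint,
    ContinuousLinearMap.comp_apply, ← inner_adjoint_comp_self_re W, hW]
  exact congrArg ENNReal.ofReal (inner_self_eq_norm_sq (𝕜 := ℂ) _)

lemma summable_of_tsum_ofReal_ne_top {p : ι → ℝ} (h0 : ∀ i, 0 ≤ p i)
    (h : ∑' i, ENNReal.ofReal (p i) ≠ ⊤) : Summable p :=
  (ENNReal.summable_toReal h).congr fun i => ENNReal.toReal_ofReal (h0 i)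

end HilbertSpace

/-! ### Fourier series on the circle -/

/-- The Fourier coefficients of a real function on the circle. -/
abbrev coeff (f : Circ → ℝ) (k : ℤ) : ℂ := fourierCoeff (fun x => (f x : ℂ)) k

lemma fourier_add_coe (k : ℤ) (x : Circ) (t : ℝ) :
    fourier k (x + (t : Circ)) =
      fourier k x * Complex.exp (((2 * Real.pi * k : ℝ) * t : ℝ) * Complex.I) := by
  have h : fourier k (x + (t : Circ)) = fourier k x * fourier k (t : Circ) := by
    simp only [fourier_apply, smul_add, AddCircle.toCircle_add, Circle.coe_mul]
  rw [h, fourier_coe_apply]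
  congr 2
  push_cast
  ring

lemma hasDerivAt_re_mul_exp (c : ℂ) (w t : ℝ) :
    HasDerivAt (fun s : ℝ => (c * Complex.exp ((w * s : ℝ) * Complex.I)).re)
      ((c * (w * Complex.I) * Complex.exp ((w * t : ℝ) * Complex.I)).re) t := by
  have h1 : HasDerivAt (fun s : ℝ => ((w * s : ℝ) * Complex.I : ℂ)) (w * Complex.I) t := by
    have := (((hasDerivAt_id t).const_mul w).ofReal_comp.mul_const Complex.I)
    simpa using this
  have h2 := (h1.cexp.const_mul c)
  have h3 := Complex.reCLM.hasFDerivAt.comp_hasDerivAt t h2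
  refine h3.congr_deriv ?_
  rw [Complex.reCLM_apply, mul_assoc, mul_comm (Complex.exp _)]

lemma isTest_re_mul_fourier (c : ℂ) (k : ℤ) : IsTest fun x => (c * fourier k x).re := by
  have : (fun t : ℝ => (c * fourier k (t : Circ)).re) =
      fun t : ℝ => (c * Complex.exp (((2 * Real.pi * k : ℝ) * t : ℝ) * Complex.I)).re := by
    funext t
    have := fourier_add_coe k 0 t
    rw [zero_add, fourier_eval_zero, one_mul] at this
    rw [this]
  rw [IsTest, this]
  refine Complex.reCLM.contDiff.comp (contDiff_const.mul (ContDiff.cexp ?_))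
  exact (Complex.ofRealCLM.contDiff.comp (contDiff_const.mul contDiff_id)).mul contDiff_const

lemma secondDeriv_re_mul_fourier (c : ℂ) (k : ℤ) (x : Circ) :
    secondDeriv (fun x => (c * fourier k x).re) x =
      -(4 * Real.pi ^ 2 * (k : ℝ) ^ 2) * (c * fourier k x).re := by
  simp only [secondDeriv, fourier_add_coe, ← mul_assoc]
  rw [iteratedDeriv_succ, iteratedDeriv_one]
  have h1 := fun t => (hasDerivAt_re_mul_exp (c * fourier k x) (2 * Real.pi * k) t).deriv
  rw [funext h1, (hasDerivAt_re_mul_exp _ _ _).deriv]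
  have : c * fourier k x * (((2 * Real.pi * k : ℝ) : ℂ) * Complex.I) *
      (((2 * Real.pi * k : ℝ) : ℂ) * Complex.I) *
        Complex.exp (((2 * Real.pi * k : ℝ) * (0 : ℝ) : ℝ) * Complex.I) =
      ((-(4 * Real.pi ^ 2 * (k : ℝ) ^ 2) : ℝ) : ℂ) * (c * fourier k x) := by
    rw [mul_zero, Complex.ofReal_zero, zero_mul, Complex.exp_zero]
    push_cast
    linear_combination (4 * Real.pi ^ 2 * (k : ℂ) ^ 2 * c * fourier k x) * Complex.I_sq
  rw [this, Complex.re_ofReal_mul]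

lemma integrable_fourier_mul {f : Circ → ℝ} (hf : Integrable f dx) (k : ℤ) :
    Integrable (fun x => fourier k x * (f x : ℂ)) dx := by
  refine hf.ofReal.bdd_mul (c := 1) (by fun_prop) (Eventually.of_forall fun x => ?_)
  rw [fourier_apply, Circle.norm_coe]

lemma re_mul_coeff {f : Circ → ℝ} (hf : Integrable f dx) (c : ℂ) (k : ℤ) :
    (c * coeff f k).re = ∫ x, f x * (c * fourier (-k) x).re ∂dx := by
  have h0 : coeff f k = ∫ x, fourier (-k) x * (f x : ℂ) ∂dx := rfl
  rw [h0, ← integral_const_mul]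
  have h := (integrable_fourier_mul hf (-k)).const_mul c
  have h2 := Complex.reCLM.integral_comp_comm h
  simp only [Complex.reCLM_apply] at h2
  rw [← h2]
  refine integral_congr_ae (Eventually.of_forall fun x => ?_)
  simp only
  rw [← mul_assoc, mul_comm, Complex.re_ofReal_mul]

/-- The equation `-V'' = μ - f` in terms of Fourier coefficients, obtained by testing with the real
parts of multiples of exponentials. -/
lemma WeakPoisson.coeff_eq {V f : Circ → ℝ} {μ : Measure Circ} [IsFiniteMeasure μ]
    (h : WeakPoisson V μ f) (hV : Integrable V dx) (hf : Integrable f dx) (k : ℤ) :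
    ((4 * Real.pi ^ 2 * (k : ℝ) ^ 2 : ℝ) : ℂ) * coeff V k =
      (∫ x, fourier (-k) x ∂μ) - coeff f k := by
  have hμ : Integrable (fun x => fourier (-k) x) μ := by
    refine Integrable.of_bound (C := 1) (by fun_prop) (Eventually.of_forall fun x => ?_)
    rw [fourier_apply, Circle.norm_coe]
  have key : ∀ c : ℂ, (c * (((4 * Real.pi ^ 2 * (k : ℝ) ^ 2 : ℝ) : ℂ) * coeff V k)).re =
      (c * ((∫ x, fourier (-k) x ∂μ) - coeff f k)).re := by
    intro c
    have h1 := h _ (isTest_re_mul_fourier c (-k))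
    simp only [secondDeriv_re_mul_fourier] at h1
    have h2 : (c * ∫ x, fourier (-k) x ∂μ).re = ∫ x, (c * fourier (-k) x).re ∂μ := by
      rw [← integral_const_mul]
      exact (Complex.reCLM.integral_comp_comm (hμ.const_mul c)).symm
    rw [mul_sub, Complex.sub_re, h2, re_mul_coeff hf, ← h1, mul_left_comm, Complex.re_ofReal_mul,
      re_mul_coeff hV, ← integral_const_mul, ← integral_neg]
    refine integral_congr_ae (Eventually.of_forall fun x => ?_)
    simp only
    push_cast
    ring
  -- The real and the imaginary part.
  apply Complex.ext
  · simpa using key 1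
  · simpa using key (-Complex.I)

lemma summable_one_div_int_sq : Summable fun k : ℤ => 1 / (k : ℝ) ^ 2 :=
  Real.summable_one_div_int_pow.2 one_lt_two

/-- Fourier series of `H¹` functions converge absolutely, by `2 |c| ≤ k² |c|² + 1 / k²`. -/
lemma MemH1.summable_norm_coeff {f : Circ → ℝ} (hf : MemH1 f) :
    Summable fun k => ‖coeff f k‖ := by
  refine Summable.of_norm_bounded_eventually (hf.2.add summable_one_div_int_sq) ?_
  filter_upwards [(Set.finite_singleton (0 : ℤ)).compl_mem_cofinite] with k hk
  have hk : (k : ℝ) ≠ 0 := by simpa using hk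
  have hk2 : 0 < (k : ℝ) ^ 2 := by positivity
  set c := ‖coeff f k‖
  have h0 : 0 ≤ c := norm_nonneg _
  rw [norm_norm]
  change c ≤ (1 + (k : ℝ) ^ 2) * c ^ 2 + 1 / (k : ℝ) ^ 2
  have h1 : c * 1 ≤ (k : ℝ) ^ 2 * c ^ 2 + 1 / (k : ℝ) ^ 2 := by
    have h2 : (k : ℝ) ^ 2 * (1 / (k : ℝ) ^ 2) = 1 := by field_simp
    have h3 : 0 < 1 / (k : ℝ) ^ 2 := by positivity
    nlinarith [sq_nonneg ((k : ℝ) ^ 2 * c - 1), sq_nonneg ((k : ℝ) ^ 2 * c)]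
  nlinarith [sq_nonneg c]

/-- An `L²` function with summable Fourier coefficients is a.e. the sum of its Fourier series. -/
lemma ae_hasSum_fourier {f : Circ → ℂ} (hf : MemLp f 2 dx)
    (hs : Summable fun k => ‖fourierCoeff f k‖) :
    ∀ᵐ x ∂dx, HasSum (fun k => fourierCoeff f k * fourier k x) (f x) := by
  have hsum : Summable fun k => fourierCoeff f k • (fourier k : C(Circ, ℂ)) := by
    refine Summable.of_norm ?_
    simpa [norm_smul, fourier_norm] using hs
  have h1 := hsum.hasSum.mapL (ContinuousMap.toLp (E := ℂ) 2 dx ℂ)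
  have h2 := hasSum_fourier_series_L2 (hf.toLp f)
  have h3 : (ContinuousMap.toLp (E := ℂ) 2 dx ℂ) (∑' k, fourierCoeff f k • fourier k) =
      hf.toLp f := by
    refine h1.unique ?_
    convert h2 using 2 with k
    rw [map_smul]
    congr 1
    exact congrFun (fourierCoeff_congr_ae hf.coeFn_toLp.symm) k
  have h4 := ContinuousMap.coeFn_toLp (p := 2) (𝕜 := ℂ) dx (∑' k, fourierCoeff f k • fourier k)
  rw [h3] at h4
  filter_upwards [h4, hf.coeFn_toLp] with x hx hx'
  rw [← hx', hx]
  have := hsum.hasSum.mapL (ContinuousMap.evalCLM ℂ x)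
  simpa using this

/-- Parseval's identity for real functions. -/
lemma hasSum_coeff_mul {f g : Circ → ℝ} (hf : MemLp f 2 dx) (hg : MemLp g 2 dx) :
    HasSum (fun k => (star (coeff f k) * coeff g k).re) (∫ x, f x * g x ∂dx) := by
  have hF : MemLp (fun x => (f x : ℂ)) 2 dx := hf.ofReal
  have hG : MemLp (fun x => (g x : ℂ)) 2 dx := hg.ofReal
  have h1 := (Complex.hasSum_iff _ _).1
    (fourierBasis.hasSum_inner_mul_inner (hF.toLp _) (hG.toLp _)) |>.1
  have hcF : ∀ k, inner ℂ (fourierBasis k) (hF.toLp _) = coeff f k := fun k => by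
    rw [← HilbertBasis.repr_apply_apply, fourierBasis_repr]
    exact congrFun (fourierCoeff_congr_ae hF.coeFn_toLp) k
  have hcG : ∀ k, inner ℂ (fourierBasis k) (hG.toLp _) = coeff g k := fun k => by
    rw [← HilbertBasis.repr_apply_apply, fourierBasis_repr]
    exact congrFun (fourierCoeff_congr_ae hG.coeFn_toLp) k
  convert h1 using 1
  · funext k
    rw [hcG, ← inner_conj_symm, hcF]
    rfl
  · rw [L2.inner_def, ← Complex.ofReal_re (∫ x, f x * g x ∂dx), ← integral_complex_ofReal]
    congr 1
    refine integral_congr_ae ?_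
    filter_upwards [hF.coeFn_toLp, hG.coeFn_toLp] with x h1 h2
    rw [h1, h2]
    simp [mul_comm]

lemma coeff_sub {f g : Circ → ℝ} (hf : Integrable f dx) (hg : Integrable g dx) (k : ℤ) :
    coeff (fun x => f x - g x) k = coeff f k - coeff g k := by
  simp only [coeff, fourierCoeff, smul_eq_mul, Complex.ofReal_sub, mul_sub]
  exact integral_sub (integrable_fourier_mul hf _) (integrable_fourier_mul hg _)

lemma coeff_zero (f : Circ → ℝ) : coeff f 0 = ((∫ x, f x ∂dx : ℝ) : ℂ) := by
  simp [coeff, fourierCoeff, integral_complex_ofReal]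

lemma MemH1.integrable {f : Circ → ℝ} (hf : MemH1 f) : Integrable f dx :=
  hf.1.integrable one_le_two

/-- Functions in `H¹(𝕋)` are essentially bounded. -/
lemma MemH1.exists_bound {f : Circ → ℝ} (hf : MemH1 f) : ∃ M, ∀ᵐ x ∂dx, |f x| ≤ M := by
  refine ⟨∑' k, ‖coeff f k‖, ?_⟩
  filter_upwards [ae_hasSum_fourier hf.1.ofReal hf.summable_norm_coeff] with x hx
  have h := tsum_of_norm_bounded (f := fun k => coeff f k * fourier k x)
    hf.summable_norm_coeff.hasSum fun k => by
      rw [norm_mul, fourier_apply, Circle.norm_coe, mul_one]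
  have h2 : ∑' k, coeff f k * fourier k x = (f x : ℂ) := hx.tsum_eq
  rwa [h2, Complex.norm_real] at h

/-! ### Stability of the Poisson–Boltzmann potential -/

/-- If `∑ k, 4π²k² |ĉ(k)|² ≤ 2ε`, the function `f` is within `(1 + C) √ε` of its mean, where
`C = ∑ k ≠ 0, 1 / k²`: the one-dimensional Sobolev inequality. In the sum over all of `ℤ` the term
`1 / 0 ^ 2` is zero. -/
lemma ae_abs_sub_mean_le {f : Circ → ℝ} (hf : MemLp f 2 dx) (hs : Summable fun k => ‖coeff f k‖)
    {ε S : ℝ} (hε : 0 < ε)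
    (hS : HasSum (fun k : ℤ => 4 * Real.pi ^ 2 * (k : ℝ) ^ 2 * ‖coeff f k‖ ^ 2) S)
    (hSε : S ≤ 2 * ε) :
    ∀ᵐ x ∂dx, |f x - ∫ y, f y ∂dx| ≤ (1 + ∑' k : ℤ, 1 / (k : ℝ) ^ 2) * √ε := by
  have hr : 0 < √ε := Real.sqrt_pos.2 hε
  have hrr : √ε * √ε = ε := Real.mul_self_sqrt hε.le
  set C := ∑' k : ℤ, 1 / (k : ℝ) ^ 2
  have hC0 : 0 ≤ C := tsum_nonneg fun k => by positivity
  -- Termwise, `|ĉ(k)| ≤ (4π²k² |ĉ(k)|² / √ε + √ε / k²) / 2` for `k ≠ 0`.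
  have hbound := ((hS.div_const √ε).add (summable_one_div_int_sq.hasSum.mul_right √ε)).div_const 2
  filter_upwards [ae_hasSum_fourier hf.ofReal hs] with x hx
  have h1 := hx.sub (hasSum_ite_eq (0 : ℤ) (coeff f 0))
  have h2 := tsum_of_norm_bounded hbound (f := fun k : ℤ =>
      coeff f k * fourier k x - if k = 0 then coeff f 0 else 0) (fun k => by
    by_cases hk : k = 0
    · subst hk
      simp
    · have hk' : (k : ℝ) ≠ 0 := by exact_mod_cast hk
      have hk2 : 0 < (k : ℝ) ^ 2 := by positivity
      rw [if_neg hk, sub_zero, norm_mul, fourier_apply, Circle.norm_coe, mul_one]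
      set c := ‖coeff f k‖
      have hp : 1 ≤ 4 * Real.pi ^ 2 := by nlinarith [Real.pi_gt_three]
      have h3 : (k : ℝ) ^ 2 * c ^ 2 ≤ 4 * Real.pi ^ 2 * (k : ℝ) ^ 2 * c ^ 2 := by
        nlinarith [mul_nonneg hk2.le (sq_nonneg c)]
      have h4 : (k : ℝ) ^ 2 * c ^ 2 / √ε ≤ 4 * Real.pi ^ 2 * (k : ℝ) ^ 2 * c ^ 2 / √ε := by
        gcongr
      have h5 : 2 * c ≤ (k : ℝ) ^ 2 * c ^ 2 / √ε + 1 / (k : ℝ) ^ 2 * √ε := by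
        have : (k : ℝ) ^ 2 * c ^ 2 / √ε + 1 / (k : ℝ) ^ 2 * √ε - 2 * c =
            ((k : ℝ) ^ 2 * c - √ε) ^ 2 / ((k : ℝ) ^ 2 * √ε) := by
          field_simp
          ring
        have h6 : 0 ≤ ((k : ℝ) ^ 2 * c - √ε) ^ 2 / ((k : ℝ) ^ 2 * √ε) := by positivity
        linarith
      linarith)
  have h8 : ∑' k : ℤ, (coeff f k * fourier k x - if k = 0 then coeff f 0 else 0) =
      (f x : ℂ) - coeff f 0 := h1.tsum_eq
  rw [h8, coeff_zero, ← Complex.ofReal_sub, Complex.norm_real, Real.norm_eq_abs] at h2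
  refine h2.trans ?_
  have h7 : S / √ε ≤ 2 * √ε := by
    rw [div_le_iff₀ hr]
    linarith
  nlinarith [mul_nonneg hC0 hr.le]

namespace IsPoissonBoltzmann

variable {N : ℕ} {X Y : Config N} {Vt Vh Vt' Vh' : Circ → ℝ}

lemma exists_bound (h : IsPoissonBoltzmann X Vt Vh) : ∃ M, ∀ᵐ x ∂dx, |Vt x + Vh x| ≤ M := by
  obtain ⟨M₁, h₁⟩ := h.memH1_tilde.exists_bound
  obtain ⟨M₂, h₂⟩ := h.memH1_hat.exists_bound
  refine ⟨M₁ + M₂, ?_⟩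
  filter_upwards [h₁, h₂] with x h₁ h₂
  exact (abs_add_le _ _).trans (add_le_add h₁ h₂)

lemma aestronglyMeasurable (h : IsPoissonBoltzmann X Vt Vh) :
    AEStronglyMeasurable (fun x => Vt x + Vh x) dx :=
  h.memH1_tilde.1.aestronglyMeasurable.add h.memH1_hat.1.aestronglyMeasurable

lemma memLp_exp (h : IsPoissonBoltzmann X Vt Vh) :
    MemLp (fun x => Real.exp (Vt x + Vh x)) 2 dx := by
  obtain ⟨M, hM⟩ := h.exists_bound
  refine MemLp.of_bound (Real.continuous_exp.comp_aestronglyMeasurable h.aestronglyMeasurable)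
    (Real.exp M) ?_
  filter_upwards [hM] with x hx
  rw [Real.norm_eq_abs, Real.abs_exp]
  exact Real.exp_le_exp.2 ((le_abs_self _).trans hx)

lemma coeff_hat (h : IsPoissonBoltzmann X Vt Vh) (k : ℤ) :
    ((4 * Real.pi ^ 2 * (k : ℝ) ^ 2 : ℝ) : ℂ) * coeff Vh k =
      (∫ x, fourier (-k) x ∂dx) - coeff (fun x => Real.exp (Vt x + Vh x)) k :=
  h.eq_hat.coeff_eq h.memH1_hat.integrable (h.memLp_exp.integrable one_le_two) k

/-- The measure `exp (V) dx` has mass one. -/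
lemma integral_exp (h : IsPoissonBoltzmann X Vt Vh) : ∫ x, Real.exp (Vt x + Vh x) ∂dx = 1 := by
  have h1 := h.coeff_hat 0
  rw [coeff_zero] at h1
  simp only [Int.cast_zero, neg_zero, fourier_zero, integral_const, probReal_univ, one_smul,
    coeff_zero] at h1
  simp only [ne_eq, OfNat.ofNat_ne_zero, not_false_eq_true, zero_pow, mul_zero,
    Complex.ofReal_zero, zero_mul] at h1
  exact_mod_cast (sub_eq_zero.1 h1.symm).symm

/-- Two functions `V`, `V'` for which `exp V` and `exp V'` have the same mass cannot be ordered
strictly. -/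
lemma not_forall_lt (h : IsPoissonBoltzmann X Vt Vh) (h' : IsPoissonBoltzmann Y Vt' Vh') :
    ¬ ∀ᵐ x ∂dx, Vt x + Vh x < Vt' x + Vh' x := by
  intro hlt
  have hint := h.memLp_exp.integrable one_le_two
  have hint' := h'.memLp_exp.integrable one_le_two
  have h0 : ∫ x, (Real.exp (Vt' x + Vh' x) - Real.exp (Vt x + Vh x)) ∂dx = 0 := by
    rw [integral_sub hint' hint, h.integral_exp, h'.integral_exp, sub_self]
  have hnn : 0 ≤ᵐ[dx] fun x => Real.exp (Vt' x + Vh' x) - Real.exp (Vt x + Vh x) := by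
    filter_upwards [hlt] with x hx
    exact sub_nonneg.2 (Real.exp_le_exp.2 hx.le)
  rw [integral_eq_zero_iff_of_nonneg_ae hnn (hint'.sub hint)] at h0
  have : ∀ᵐ x ∂dx, False := by
    filter_upwards [hlt, h0] with x hx hx0
    have := Real.exp_lt_exp.2 hx
    simp only [Pi.zero_apply] at hx0
    linarith
  exact absurd (Filter.eventually_false_iff_eq_bot.1 this) (by
    rw [ae_eq_bot]
    exact IsProbabilityMeasure.ne_zero dx)

/-- Stability of the Poisson–Boltzmann potential: `V = Vt + Vh` depends continuously, in the uniform
norm, on `Vt`. Testing the difference of the two equations with `D = Vh - Vh'` and using that `exp`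
is increasing bounds `∫ |D'|²`; so `D` is nearly constant, and the constant is controlled by the
normalisation `∫ exp (V) = 1`. -/
theorem ae_abs_sub_le (h : IsPoissonBoltzmann X Vt Vh) (h' : IsPoissonBoltzmann Y Vt' Vh')
    {ε : ℝ} (hε : 0 < ε) (hd : ∀ᵐ x ∂dx, |Vt x - Vt' x| ≤ ε) :
    ∀ᵐ x ∂dx, |(Vt x + Vh x) - (Vt' x + Vh' x)| ≤
      2 * ((1 + ∑' k : ℤ, 1 / (k : ℝ) ^ 2) * √ε) + 2 * ε := by
  let D : Circ → ℝ := fun x => Vh x - Vh' x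
  let g : Circ → ℝ := fun x => Real.exp (Vt' x + Vh' x) - Real.exp (Vt x + Vh x)
  have hD : MemLp D 2 dx := h.memH1_hat.1.sub h'.memH1_hat.1
  have hg : MemLp g 2 dx := h'.memLp_exp.sub h.memLp_exp
  have hint := h.memLp_exp.integrable one_le_two
  have hint' := h'.memLp_exp.integrable one_le_two
  have hDc : ∀ k, coeff D k = coeff Vh k - coeff Vh' k :=
    coeff_sub h.memH1_hat.integrable h'.memH1_hat.integrable
  have hDg : ∀ k : ℤ, coeff g k = ((4 * Real.pi ^ 2 * (k : ℝ) ^ 2 : ℝ) : ℂ) * coeff D k := by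
    intro k
    rw [coeff_sub hint' hint, hDc, mul_sub, h.coeff_hat, h'.coeff_hat]
    ring
  have hP := hasSum_coeff_mul hD hg
  -- Parseval's identity gives `∫ D g = ∑ k, 4π²k² |D̂(k)|²`, that is, `∫ |D'|²`.
  have hS : HasSum (fun k : ℤ => 4 * Real.pi ^ 2 * (k : ℝ) ^ 2 * ‖coeff D k‖ ^ 2)
      (∫ x, D x * g x ∂dx) := by
    refine hP.congr_fun fun k => ?_
    rw [hDg, mul_left_comm, Complex.re_ofReal_mul, mul_comm (star _)]
    congr 1
    have := Complex.mul_conj (coeff D k)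
    rw [starRingEnd_apply] at this
    rw [this, Complex.ofReal_re, Complex.normSq_eq_norm_sq]
  -- `D g = (V - V') g - (Vt - Vt') g`, and the first term is nonpositive by monotonicity of `exp`.
  have hSε : ∫ x, D x * g x ∂dx ≤ 2 * ε := by
    have h1 : ∫ x, ε * (Real.exp (Vt x + Vh x) + Real.exp (Vt' x + Vh' x)) ∂dx = 2 * ε := by
      rw [integral_const_mul, integral_add hint hint', h.integral_exp, h'.integral_exp]
      ring
    rw [← h1]
    refine integral_mono_ae (hD.integrable_mul hg) ((hint.add hint').const_mul ε) ?_
    filter_upwards [hd] with x hx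
    set v := Vt x + Vh x
    set v' := Vt' x + Vh' x
    have e1 : D x * g x = (v - v') * (Real.exp v' - Real.exp v) -
        (Vt x - Vt' x) * (Real.exp v' - Real.exp v) := by
      simp only [D, g, v, v']
      ring
    have e2 : (v - v') * (Real.exp v' - Real.exp v) ≤ 0 := by
      rcases le_total v v' with hv | hv
      · exact mul_nonpos_of_nonpos_of_nonneg (by linarith) (by linarith [Real.exp_le_exp.2 hv])
      · exact mul_nonpos_of_nonneg_of_nonpos (by linarith) (by linarith [Real.exp_le_exp.2 hv])
    have e3 : |(Vt x - Vt' x) * (Real.exp v' - Real.exp v)| ≤ ε * (Real.exp v + Real.exp v') := by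
      rw [abs_mul]
      refine mul_le_mul hx ?_ (abs_nonneg _) hε.le
      exact (abs_sub _ _).trans (by rw [Real.abs_exp, Real.abs_exp, add_comm])
    have e4 := neg_abs_le ((Vt x - Vt' x) * (Real.exp v' - Real.exp v))
    change D x * g x ≤ ε * (Real.exp v + Real.exp v')
    linarith
  have hs : Summable fun k => ‖coeff D k‖ := by
    refine Summable.of_nonneg_of_le (fun _ => norm_nonneg _) (fun k => ?_)
      (h.memH1_hat.summable_norm_coeff.add h'.memH1_hat.summable_norm_coeff)
    rw [hDc]
    exact norm_sub_le _ _
  have hmean := ae_abs_sub_mean_le hD hs hε hS hSε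
  set δ := (1 + ∑' k : ℤ, 1 / (k : ℝ) ^ 2) * √ε
  set c := ∫ x, D x ∂dx
  -- If the mean of `D` were too large, then `V > V'` everywhere, contradicting equality of masses.
  have hc1 : c ≤ δ + ε := by
    by_contra! hc
    refine h'.not_forall_lt h ?_
    filter_upwards [hmean, hd] with x h1 h2
    have h3 := (abs_le.1 h1).1
    have h4 := (abs_le.1 h2).1
    simp only [D] at h3
    linarith
  have hc2 : -(δ + ε) ≤ c := by
    by_contra! hc
    refine h.not_forall_lt h' ?_
    filter_upwards [hmean, hd] with x h1 h2
    have h3 := (abs_le.1 h1).2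
    have h4 := (abs_le.1 h2).2
    simp only [D] at h3
    linarith
  filter_upwards [hmean, hd] with x h1 h2
  have h3 := abs_le.1 h1
  have h4 := abs_le.1 h2
  simp only [D] at h3
  rw [abs_le]
  constructor <;> linarith

/-- `Vt` is controlled in the uniform norm by the Fourier coefficients of the empirical measure. The
coefficient at `k = 0`, which the equation does not determine, vanishes because `Vt` has mean zero. -/
theorem ae_abs_tilde_sub_le [IsFiniteMeasure (empirical X)] [IsFiniteMeasure (empirical Y)]
    (h : IsPoissonBoltzmann X Vt Vh) (h' : IsPoissonBoltzmann Y Vt' Vh') {r : ℝ}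
    (hr : HasSum (fun k : ℤ => ‖(∫ x, fourier (-k) x ∂empirical X) -
      ∫ x, fourier (-k) x ∂empirical Y‖ * (1 / (k : ℝ) ^ 2)) r) :
    ∀ᵐ x ∂dx, |Vt x - Vt' x| ≤ r := by
  have hD : MemLp (fun x => Vt x - Vt' x) 2 dx := h.memH1_tilde.1.sub h'.memH1_tilde.1
  have hle : ∀ k, ‖coeff (fun x => Vt x - Vt' x) k‖ ≤ ‖(∫ x, fourier (-k) x ∂empirical X) -
      ∫ x, fourier (-k) x ∂empirical Y‖ * (1 / (k : ℝ) ^ 2) := by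
    intro k
    rw [coeff_sub h.memH1_tilde.integrable h'.memH1_tilde.integrable]
    by_cases hk : k = 0
    · subst hk
      rw [coeff_zero, coeff_zero, h.mean_zero, h'.mean_zero]
      simp
    · have hk' : (k : ℝ) ≠ 0 := by exact_mod_cast hk
      have h1 := h.eq_tilde.coeff_eq h.memH1_tilde.integrable (integrable_const 1) k
      have h2 := h'.eq_tilde.coeff_eq h'.memH1_tilde.integrable (integrable_const 1) k
      have h3 : ((4 * Real.pi ^ 2 * (k : ℝ) ^ 2 : ℝ) : ℂ) * (coeff Vt k - coeff Vt' k) =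
          (∫ x, fourier (-k) x ∂empirical X) - ∫ x, fourier (-k) x ∂empirical Y := by
        rw [mul_sub, h1, h2]
        ring
      rw [← h3, norm_mul, Complex.norm_real, Real.norm_of_nonneg (by positivity)]
      have h4 : 4 * Real.pi ^ 2 * (k : ℝ) ^ 2 * ‖coeff Vt k - coeff Vt' k‖ * (1 / (k : ℝ) ^ 2) =
          4 * Real.pi ^ 2 * ‖coeff Vt k - coeff Vt' k‖ := by field_simp
      rw [h4]
      have hp : 1 ≤ 4 * Real.pi ^ 2 := by nlinarith [Real.pi_gt_three]
      exact le_mul_of_one_le_left (norm_nonneg _) hp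
  have hs := Summable.of_nonneg_of_le (fun _ => norm_nonneg _) hle hr.summable
  filter_upwards [ae_hasSum_fourier hD.ofReal hs] with x hx
  have h1 := tsum_of_norm_bounded hr (f := fun k => coeff (fun x => Vt x - Vt' x) k * fourier k x)
    (fun k => by
      rw [norm_mul, fourier_apply, Circle.norm_coe, mul_one]
      exact hle k)
  have h2 : ∑' k, coeff (fun x => Vt x - Vt' x) k * fourier k x = ((Vt x - Vt' x : ℝ) : ℂ) :=
    hx.tsum_eq
  rwa [h2, Complex.norm_real] at h1

end IsPoissonBoltzmann

/-! ### Continuity and symmetry of the potential energy -/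

lemma integral_empirical {N : ℕ} {F : Type*} [NormedAddCommGroup F] [NormedSpace ℝ F]
    [CompleteSpace F] (X : Config N) (f : Circ → F) :
    ∫ x, f x ∂empirical X = (N : ℝ)⁻¹ • ∑ j, f (X j) := by
  rw [empirical, integral_smul_measure, integral_finsetSum_measure]
  · simp [integral_dirac]
  · exact fun j _ => integrable_dirac (by simp)

lemma isFiniteMeasure_empirical {N : ℕ} (hN : 1 ≤ N) (X : Config N) :
    IsFiniteMeasure (empirical X) := by
  refine ⟨?_⟩
  simp only [empirical, Measure.smul_apply, Measure.finsetSum_apply, measure_univ,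
    Finset.sum_const, Finset.card_univ, Fintype.card_fin, smul_eq_mul]
  exact ENNReal.mul_lt_top (by simpa using Nat.pos_of_ne_zero (by omega)) (by simp)

lemma continuous_green : Continuous green := by
  unfold green
  fun_prop

lemma exists_abs_green_le : ∃ K, ∀ x, |green x| ≤ K := by
  obtain ⟨K, hK⟩ := isCompact_univ.exists_bound_of_continuousOn continuous_green.continuousOn
  exact ⟨K, fun x => hK x (mem_univ x)⟩

lemma integral_gibbs {V : Circ → ℝ} (hV : AEStronglyMeasurable V dx) (f : Circ → ℝ) :
    ∫ x, f x ∂gibbs V = ∫ x, Real.exp (V x) * f x ∂dx := by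
  rw [gibbs, integral_withDensity_eq_integral_toReal_smul₀ (by fun_prop) (by simp)]
  simp [ENNReal.toReal_ofReal (Real.exp_pos _).le]

lemma tendsto_modulus {r : ℕ → ℝ} (hr : Tendsto r atTop (𝓝 0)) (C : ℝ) :
    Tendsto (fun n => 2 * (C * √(r n)) + 2 * r n) atTop (𝓝 0) := by
  have := ((hr.sqrt.const_mul C).const_mul 2).add (hr.const_mul 2)
  simpa using this

/-- Potentials of configurations with the same empirical measure agree almost everywhere. -/
lemma ae_eq_of_empirical_eq {N : ℕ} (hN : 1 ≤ N) {X Y : Config N} {Vt Vh Vt' Vh' : Circ → ℝ}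
    (h : IsPoissonBoltzmann X Vt Vh) (h' : IsPoissonBoltzmann Y Vt' Vh')
    (he : empirical X = empirical Y) :
    (fun x => Vt x + Vh x) =ᵐ[dx] fun x => Vt' x + Vh' x := by
  have := isFiniteMeasure_empirical hN X
  have := isFiniteMeasure_empirical hN Y
  have h0 : ∀ᵐ x ∂dx, |Vt x - Vt' x| ≤ 0 :=
    h.ae_abs_tilde_sub_le h' (by simp only [he, sub_self, norm_zero, zero_mul]; exact hasSum_zero)
  have h1 : ∀ n : ℕ, ∀ᵐ x ∂dx, |(Vt x + Vh x) - (Vt' x + Vh' x)| ≤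
      2 * ((1 + ∑' k : ℤ, 1 / (k : ℝ) ^ 2) * √(1 / ((n : ℝ) + 1))) + 2 * (1 / ((n : ℝ) + 1)) :=
    fun n => h.ae_abs_sub_le h' (by positivity) (h0.mono fun x hx => hx.trans (by positivity))
  filter_upwards [ae_all_iff.2 h1] with x hx
  have h2 := ge_of_tendsto' (tendsto_modulus tendsto_one_div_add_atTop_nhds_zero_nat
    (1 + ∑' k : ℤ, 1 / (k : ℝ) ^ 2)) hx
  exact sub_eq_zero.1 (abs_nonpos_iff.1 h2)

/-- The potential depends continuously on the configuration, in the uniform norm. -/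
lemma exists_tendsto_zero_bound {N : ℕ} (hN : 1 ≤ N) {Vt Vh : Config N → Circ → ℝ}
    (hV : ∀ X, IsPoissonBoltzmann X (Vt X) (Vh X)) {u : ℕ → Config N} {X : Config N}
    (hu : Tendsto u atTop (𝓝 X)) :
    ∃ η : ℕ → ℝ, Tendsto η atTop (𝓝 0) ∧
      ∀ n, ∀ᵐ x ∂dx, |(Vt (u n) x + Vh (u n) x) - (Vt X x + Vh X x)| ≤ η n := by
  have := fun Y : Config N => isFiniteMeasure_empirical hN Y
  let a : ℕ → ℤ → ℝ := fun n k => ‖(∫ x, fourier (-k) x ∂empirical (u n)) -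
      ∫ x, fourier (-k) x ∂empirical X‖ * (1 / (k : ℝ) ^ 2)
  have hN0 : (N : ℝ) ≠ 0 := by exact_mod_cast (by omega : N ≠ 0)
  have h1 : ∀ (Y : Config N) (k : ℤ), ‖∫ x, fourier (-k) x ∂empirical Y‖ ≤ 1 := by
    intro Y k
    rw [integral_empirical, norm_smul, norm_inv, Real.norm_natCast]
    calc (N : ℝ)⁻¹ * ‖∑ j, fourier (-k) (Y j)‖ ≤ (N : ℝ)⁻¹ * ∑ j : Fin N, 1 := by
          gcongr
          refine norm_sum_le_of_le _ fun j _ => ?_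
          rw [fourier_apply, Circle.norm_coe]
      _ = 1 := by simp [hN0]
  have hb : ∀ n k, ‖a n k‖ ≤ 2 * (1 / (k : ℝ) ^ 2) := by
    intro n k
    rw [Real.norm_of_nonneg (by positivity)]
    refine mul_le_mul_of_nonneg_right ((norm_sub_le _ _).trans ?_) (by positivity)
    linarith [h1 (u n) k, h1 X k]
  have hsum : ∀ n, Summable (a n) := fun n =>
    Summable.of_norm_bounded (summable_one_div_int_sq.mul_left 2) (hb n)
  have hlim : Tendsto (fun n => ∑' k, a n k) atTop (𝓝 0) := by
    rw [show 𝓝 (0 : ℝ) = 𝓝 (∑' _ : ℤ, (0 : ℝ)) by rw [tsum_zero]]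
    refine tendsto_tsum_of_dominated_convergence (summable_one_div_int_sq.mul_left 2)
      (fun k => ?_) (Eventually.of_forall fun n k => hb n k)
    have h2 : Tendsto (fun n => ∫ x, fourier (-k) x ∂empirical (u n)) atTop
        (𝓝 (∫ x, fourier (-k) x ∂empirical X)) := by
      simp only [integral_empirical]
      have hc : Continuous fun Y : Config N => (N : ℝ)⁻¹ • ∑ j, fourier (-k) (Y j) := by fun_prop
      exact (hc.tendsto X).comp hu
    have h3 := ((h2.sub_const (∫ x, fourier (-k) x ∂empirical X)).norm).mul_const
      (1 / (k : ℝ) ^ 2)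
    simpa [a] using h3
  -- The second summand makes the bound strictly positive, as the stability estimate requires.
  let r : ℕ → ℝ := fun n => ∑' k, a n k + 1 / ((n : ℝ) + 1)
  have hr : Tendsto r atTop (𝓝 0) := by
    simpa [r] using hlim.add tendsto_one_div_add_atTop_nhds_zero_nat
  refine ⟨_, tendsto_modulus hr (1 + ∑' k : ℤ, 1 / (k : ℝ) ^ 2), fun n => ?_⟩
  have hpos : (0 : ℝ) < 1 / ((n : ℝ) + 1) := by positivity
  have h0 : 0 ≤ ∑' k, a n k := tsum_nonneg fun k => by positivity
  refine (hV (u n)).ae_abs_sub_le (hV X) (ε := r n) (by simp only [r]; linarith) ?_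
  filter_upwards [(hV (u n)).ae_abs_tilde_sub_le (hV X) (hsum n).hasSum] with x hx
  exact hx.trans (by simp only [r]; linarith)

/-- Passage to the limit in integrals `∫ F(v) g` under uniform convergence of `v` and bounded
pointwise convergence of `g`. -/
lemma tendsto_integral_comp_mul {v : ℕ → Circ → ℝ} {v₀ : Circ → ℝ} {η : ℕ → ℝ} {M K : ℝ}
    (hv : ∀ n, AEStronglyMeasurable (v n) dx) (hM : ∀ᵐ x ∂dx, |v₀ x| ≤ M)
    (hη : Tendsto η atTop (𝓝 0)) (hvη : ∀ n, ∀ᵐ x ∂dx, |v n x - v₀ x| ≤ η n)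
    {F : ℝ → ℝ} (hF : Continuous F) {g : ℕ → Circ → ℝ} {g₀ : Circ → ℝ}
    (hg : ∀ n, AEStronglyMeasurable (g n) dx) (hgK : ∀ n x, |g n x| ≤ K)
    (hglim : ∀ x, Tendsto (fun n => g n x) atTop (𝓝 (g₀ x))) :
    Tendsto (fun n => ∫ x, F (v n x) * g n x ∂dx) atTop (𝓝 (∫ x, F (v₀ x) * g₀ x ∂dx)) := by
  obtain ⟨B, hB⟩ := hη.bddAbove_range
  have hB : ∀ n, η n ≤ B := fun n => hB ⟨n, rfl⟩
  obtain ⟨L, hL⟩ := (isCompact_Icc (a := -(M + B)) (b := M + B)).exists_bound_of_continuousOn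
    hF.continuousOn
  refine tendsto_integral_of_dominated_convergence (fun _ => L * K)
    (fun n => (hF.comp_aestronglyMeasurable (hv n)).mul (hg n)) (integrable_const _) ?_ ?_
  · intro n
    filter_upwards [hM, hvη n] with x h1 h2
    have h3 := abs_le.1 h1
    have h4 := abs_le.1 (h2.trans (hB n))
    have h5 := hL (v n x) ⟨by linarith, by linarith⟩
    rw [norm_mul]
    exact mul_le_mul h5 (hgK n x) (abs_nonneg _) ((norm_nonneg _).trans h5)
  · filter_upwards [ae_all_iff.2 hvη] with x hx
    have h1 : Tendsto (fun n => v n x) atTop (𝓝 (v₀ x)) := by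
      rw [tendsto_iff_norm_sub_tendsto_zero]
      exact squeeze_zero (fun _ => norm_nonneg _) hx hη
    exact ((hF.tendsto _).comp h1).mul (hglim x)

/-- The potential energy `𝓘_X + 𝓥_X` is a continuous function of the configuration. -/
theorem continuous_potential {N : ℕ} (hN : 1 ≤ N) {Vt Vh : Config N → Circ → ℝ}
    (hV : ∀ X, IsPoissonBoltzmann X (Vt X) (Vh X)) :
    Continuous fun X => entropyTerm (fun X x => Vt X x + Vh X x) X +
      interactionTerm (fun X x => Vt X x + Vh X x) X := by
  refine continuous_iff_seqContinuous.2 fun u X hu => ?_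
  let V : Config N → Circ → ℝ := fun X x => Vt X x + Vh X x
  obtain ⟨η, hη, hvη⟩ := exists_tendsto_zero_bound hN hV hu
  obtain ⟨M, hM⟩ := (hV X).exists_bound
  obtain ⟨K, hK⟩ := exists_abs_green_le
  have hm : ∀ Y, AEStronglyMeasurable (V Y) dx := fun Y => (hV Y).aestronglyMeasurable
  have hint : ∀ Y, Integrable (fun x => Real.exp (V Y x)) dx := fun Y =>
    (hV Y).memLp_exp.integrable one_le_two
  have hcoord : ∀ j, Tendsto (fun n => u n j) atTop (𝓝 (X j)) := fun j =>
    ((continuous_apply j).tendsto X).comp hu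
  -- The potential `∫ e^{V(y)} K(x - y) dy` of the Gibbs measure.
  let P : Config N → Circ → ℝ := fun Y x => ∫ y, Real.exp (V Y y) * green (x - y) ∂dx
  have hPK : ∀ Y x, |P Y x| ≤ K := by
    intro Y x
    have h1 : ∫ y, Real.exp (V Y y) * K ∂dx = K := by
      rw [integral_mul_const, (hV Y).integral_exp, one_mul]
    rw [← h1, ← Real.norm_eq_abs]
    refine norm_integral_le_of_norm_le ((hint Y).mul_const K) (Eventually.of_forall fun y => ?_)
    rw [norm_mul, Real.norm_eq_abs, Real.abs_exp]
    exact mul_le_mul_of_nonneg_left (hK _) (Real.exp_pos _).le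
  have hPc : ∀ Y, Continuous (P Y) := by
    intro Y
    refine continuous_of_dominated (bound := fun y => Real.exp (V Y y) * K) (fun x => ?_)
      (fun x => Eventually.of_forall fun y => ?_) ((hint Y).mul_const K)
      (Eventually.of_forall fun y => ?_)
    · exact (hint Y).aestronglyMeasurable.mul
        (continuous_green.comp (continuous_const.sub continuous_id)).aestronglyMeasurable
    · rw [norm_mul, Real.norm_eq_abs, Real.abs_exp]
      exact mul_le_mul_of_nonneg_left (hK _) (Real.exp_pos _).le
    · exact continuous_const.mul (continuous_green.comp (continuous_id.sub continuous_const))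
  have hlim {g : ℕ → Circ → ℝ} {g₀ : Circ → ℝ} (hg : ∀ n, Continuous (g n)) {L : ℝ}
      (hgK : ∀ n x, |g n x| ≤ L) (hglim : ∀ x, Tendsto (fun n => g n x) atTop (𝓝 (g₀ x))) :
      Tendsto (fun n => ∫ x, Real.exp (V (u n) x) * g n x ∂dx) atTop
        (𝓝 (∫ x, Real.exp (V X x) * g₀ x ∂dx)) :=
    tendsto_integral_comp_mul (fun n => hm (u n)) hM hη hvη Real.continuous_exp
      (fun n => (hg n).aestronglyMeasurable) hgK hglim
  have hPlim : ∀ x, Tendsto (fun n => P (u n) x) atTop (𝓝 (P X x)) := fun x =>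
    hlim (fun n => continuous_green.comp (continuous_const.sub continuous_id)) (fun n y => hK _)
      fun y => tendsto_const_nhds
  have hentropy : Tendsto (fun n => entropyTerm V (u n)) atTop (𝓝 (entropyTerm V X)) := by
    have := tendsto_integral_comp_mul (F := fun s => s * Real.exp s) (g := fun _ _ => 1)
      (g₀ := fun _ => 1) (K := 1) (fun n => hm (u n)) hM hη hvη (by fun_prop)
      (fun n => aestronglyMeasurable_const) (fun n x => by simp) (fun x => tendsto_const_nhds)
    simp only [mul_one] at this
    exact this.const_mul _
  have h11 : Tendsto (fun n => greenPairing (empirical (u n)) (empirical (u n))) atTop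
      (𝓝 (greenPairing (empirical X) (empirical X))) := by
    simp only [greenPairing, integral_empirical]
    have hc : Continuous fun Y : Config N =>
        (N : ℝ)⁻¹ • ∑ i, (N : ℝ)⁻¹ • ∑ j, green (Y i - Y j) := by
      have := continuous_green
      fun_prop
    exact (hc.tendsto X).comp hu
  have h12 : Tendsto (fun n => greenPairing (empirical (u n)) (gibbs (V (u n)))) atTop
      (𝓝 (greenPairing (empirical X) (gibbs (V X)))) := by
    simp only [greenPairing, integral_empirical, integral_gibbs (hm _)]
    refine (tendsto_finsetSum _ fun j _ => ?_).const_smul _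
    exact hlim (fun n => continuous_green.comp (continuous_const.sub continuous_id))
      (fun n y => hK _) fun y => (continuous_green.tendsto _).comp ((hcoord j).sub_const y)
  have h21 : Tendsto (fun n => greenPairing (gibbs (V (u n))) (empirical (u n))) atTop
      (𝓝 (greenPairing (gibbs (V X)) (empirical X))) := by
    simp only [greenPairing, integral_empirical, integral_gibbs (hm _)]
    refine hlim (L := (N : ℝ)⁻¹ * ∑ j : Fin N, K) (fun n => ?_) (fun n x => ?_) fun x => ?_
    · have := continuous_green
      fun_prop
    · rw [smul_eq_mul, abs_mul, abs_of_nonneg (by positivity : (0 : ℝ) ≤ (N : ℝ)⁻¹)]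
      gcongr
      exact (Finset.abs_sum_le_sum_abs _ _).trans (Finset.sum_le_sum fun j _ => hK _)
    · refine (tendsto_finsetSum _ fun j _ => ?_).const_smul _
      exact (continuous_green.tendsto _).comp ((hcoord j).const_sub x)
  have h22 : Tendsto (fun n => greenPairing (gibbs (V (u n))) (gibbs (V (u n)))) atTop
      (𝓝 (greenPairing (gibbs (V X)) (gibbs (V X)))) := by
    simp only [greenPairing, integral_gibbs (hm _)]
    exact hlim (fun n => hPc (u n)) (fun n x => hPK _ x) hPlim
  exact hentropy.add ((((h11.sub h12).sub h21).add h22).const_mul _)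

lemma empirical_perm {N : ℕ} (X : Config N) (σ : Equiv.Perm (Fin N)) :
    empirical (fun i => X (σ i)) = empirical X := by
  rw [empirical, empirical]
  congr 1
  exact Equiv.sum_comp σ fun j => Measure.dirac (X j)

/-- The potential energy is a symmetric function of the particle positions. -/
lemma potential_perm {N : ℕ} (hN : 1 ≤ N) {Vt Vh : Config N → Circ → ℝ}
    (hV : ∀ X, IsPoissonBoltzmann X (Vt X) (Vh X)) (X : Config N) (σ : Equiv.Perm (Fin N)) :
    entropyTerm (fun X x => Vt X x + Vh X x) (fun i => X (σ i)) +
        interactionTerm (fun X x => Vt X x + Vh X x) (fun i => X (σ i)) =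
      entropyTerm (fun X x => Vt X x + Vh X x) X +
        interactionTerm (fun X x => Vt X x + Vh X x) X := by
  have hae := ae_eq_of_empirical_eq hN (hV fun i => X (σ i)) (hV X) (empirical_perm X σ)
  have hg : gibbs (fun x => Vt (fun i => X (σ i)) x + Vh (fun i => X (σ i)) x) =
      gibbs (fun x => Vt X x + Vh X x) := by
    refine withDensity_congr_ae ?_
    filter_upwards [hae] with x hx
    rw [hx]
  have he : entropyTerm (fun X x => Vt X x + Vh X x) (fun i => X (σ i)) =
      entropyTerm (fun X x => Vt X x + Vh X x) X := by
    unfold entropyTerm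
    congr 1
    refine integral_congr_ae ?_
    filter_upwards [hae] with x hx
    rw [hx]
  rw [he]
  unfold interactionTerm
  simp only [hg, empirical_perm]

/-! ### The Hamiltonian, permutations and density operators -/

variable {N : ℕ}

lemma exists_norm_le_of_continuous {W : Config N → ℝ} (hW : Continuous W) :
    ∃ M, ∀ X, ‖(W X : ℂ)‖ ≤ M := by
  obtain ⟨M, hM⟩ := isCompact_univ.exists_bound_of_continuousOn hW.continuousOn
  exact ⟨M, fun X => by simpa using hM X (mem_univ X)⟩

lemma mulOp_domain {W : Config N → ℝ} (hW : Continuous W) : (mulOp W).domain = ⊤ := by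
  obtain ⟨M, hM⟩ := exists_norm_le_of_continuous hW
  refine (Submodule.eq_top_iff'.2 fun ψ => ?_)
  refine (Lp.memLp ψ).of_le_mul (c := M) ?_ (Eventually.of_forall fun X => ?_)
  · exact (Complex.continuous_ofReal.comp hW).aestronglyMeasurable.mul (Lp.aestronglyMeasurable ψ)
  · rw [norm_mul]
    exact mul_le_mul_of_nonneg_right (hM X) (norm_nonneg _)

lemma mulOp_coeFn {W : Config N → ℝ} (ψ : (mulOp W).domain) :
    mulOp W ψ =ᵐ[dX N] fun X => (W X : ℂ) * (ψ : L2 N) X :=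
  MemLp.coeFn_toLp ψ.2

/-- Multiplication by a continuous real function is a bounded self-adjoint operator. -/
lemma exists_mulOp_eq_clm {W : Config N → ℝ} (hW : Continuous W) :
    ∃ B : L2 N →L[ℂ] L2 N, IsSelfAdjoint B ∧ (∀ ψ : (mulOp W).domain, mulOp W ψ = B ψ) ∧
      ∀ ψ, B ψ =ᵐ[dX N] fun X => (W X : ℂ) * ψ X := by
  have hdom : ∀ ψ : L2 N, ψ ∈ (mulOp W).domain := fun ψ => by rw [mulOp_domain hW]; trivial
  obtain ⟨M, hM⟩ := exists_norm_le_of_continuous hW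
  let B : L2 N →L[ℂ] L2 N := LinearMap.mkContinuous
    { toFun := fun ψ => mulOp W ⟨ψ, hdom ψ⟩
      map_add' := fun ψ φ => (mulOp W).map_add ⟨ψ, hdom ψ⟩ ⟨φ, hdom φ⟩
      map_smul' := fun c ψ => (mulOp W).map_smul c ⟨ψ, hdom ψ⟩ } M fun ψ => by
      refine Lp.norm_le_mul_norm_of_ae_le_mul ?_
      filter_upwards [mulOp_coeFn ⟨ψ, hdom ψ⟩] with X hX
      simp only [LinearMap.coe_mk, AddHom.coe_mk]
      rw [hX, norm_mul]
      exact mul_le_mul_of_nonneg_right (hM X) (norm_nonneg _)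
  have hB : ∀ ψ, B ψ =ᵐ[dX N] fun X => (W X : ℂ) * ψ X := fun ψ => mulOp_coeFn ⟨ψ, hdom ψ⟩
  refine ⟨B, ?_, fun ψ => rfl, hB⟩
  rw [ContinuousLinearMap.isSelfAdjoint_iff_isSymmetric]
  intro ψ φ
  simp only [ContinuousLinearMap.coe_coe, L2.inner_def]
  refine integral_congr_ae ?_
  filter_upwards [hB ψ, hB φ] with X h1 h2
  rw [h1, h2]
  simp
  ring

lemma repr_negLaplacian (ψ : (negLaplacian N).domain) (k : Fin N → ℤ) :
    (expBasis N).repr (negLaplacian N ψ) k = (symbol k : ℂ) * (expBasis N).repr (ψ : L2 N) k := by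
  have : negLaplacian N ψ = (expBasis N).repr.symm ⟨_, memℓp_symbol ψ⟩ := rfl
  rw [this, LinearIsometryEquiv.apply_symm_apply]

lemma symbol_nonneg (k : Fin N → ℤ) : 0 ≤ symbol k :=
  mul_nonneg (by positivity) (freqSq_nonneg k)

lemma freqSq_le_symbol (k : Fin N → ℤ) : freqSq k ≤ symbol k / 2 := by
  have := freqSq_nonneg k
  have hp : 9 < Real.pi ^ 2 := by nlinarith [Real.pi_gt_three]
  unfold symbol
  nlinarith

lemma tendsto_symbol : Tendsto (fun k : Fin N → ℤ => symbol k / 2) cofinite atTop := by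
  refine tendsto_atTop_mono freqSq_le_symbol ?_
  rw [tendsto_atTop]
  intro R
  obtain ⟨m, hm⟩ := exists_nat_gt R
  refine (Set.finite_Icc (fun _ : Fin N => -(m : ℤ)) (fun _ => (m : ℤ))).subset fun k hk => ?_
  have hk : freqSq k < R := not_le.1 hk
  have h1 : ∀ i, |k i| ≤ m := by
    intro i
    have h2 : ((k i : ℝ)) ^ 2 ≤ freqSq k :=
      Finset.single_le_sum (f := fun i => (k i : ℝ) ^ 2) (fun _ _ => sq_nonneg _)
        (Finset.mem_univ i)
    have h3 : (k i) ^ 2 ≤ (m : ℤ) := by exact_mod_cast (h2.trans (hk.le.trans hm.le))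
    have h4 : |k i| ≤ |k i| ^ 2 := by
      rcases eq_or_ne (k i) 0 with h | h
      · simp [h]
      · nlinarith [Int.one_le_abs h]
    rw [sq_abs] at h4
    exact h4.trans h3
  exact ⟨fun i => (abs_le.1 (h1 i)).1, fun i => (abs_le.1 (h1 i)).2⟩

/-- `H²` is the domain of the diagonal operator with entries `2π²|k|²`. -/
lemma mem_H2_iff (ψ : L2 N) :
    ψ ∈ H2 N ↔ Summable fun k => (symbol k / 2) ^ 2 * ‖(expBasis N).repr ψ k‖ ^ 2 := by
  have hdef : ψ ∈ H2 N ↔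
    Summable fun k => (1 + freqSq k) ^ 2 * ‖(expBasis N).repr ψ k‖ ^ 2 := Iff.rfl
  rw [hdef]
  constructor
  · intro h
    refine Summable.of_nonneg_of_le (fun k => by positivity) (fun k => ?_)
      (h.mul_left ((2 * Real.pi ^ 2) ^ 2))
    have h0 := freqSq_nonneg k
    have h1 : symbol k / 2 = 2 * Real.pi ^ 2 * freqSq k := by unfold symbol; ring
    rw [h1, mul_pow, mul_assoc]
    gcongr
    linarith
  · intro h
    refine Summable.of_nonneg_of_le (fun k => by positivity) (fun k => ?_)
      (((hasSum_norm_sq_repr (expBasis N) ψ).summable.add h).mul_left 2)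
    have h0 := freqSq_nonneg k
    have h1 := freqSq_le_symbol k
    have h2 : (1 + freqSq k) ^ 2 ≤ 2 * (1 + (symbol k / 2) ^ 2) := by
      nlinarith [sq_nonneg (1 - freqSq k)]
    calc _ ≤ 2 * (1 + (symbol k / 2) ^ 2) * ‖(expBasis N).repr ψ k‖ ^ 2 := by gcongr
      _ = _ := by ring

section Hamiltonian

variable {V : Config N → Circ → ℝ} (hW : Continuous fun X => entropyTerm V X + interactionTerm V X)
include hW

lemma hamiltonian_domain : (hamiltonian V).domain = H2 N := by
  have h : (hamiltonian V).domain = (negLaplacian N).domain ⊓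
    (mulOp fun X => entropyTerm V X + interactionTerm V X).domain := rfl
  rw [h, mulOp_domain hW, inf_top_eq]
  rfl

lemma exists_hamiltonian_eq : ∃ B : L2 N →L[ℂ] L2 N, IsSelfAdjoint B ∧
    (∀ (φ : (hamiltonian V).domain) k, (expBasis N).repr (hamiltonian V φ) k =
      ((symbol k / 2 : ℝ) : ℂ) * (expBasis N).repr (φ : L2 N) k + (expBasis N).repr (B φ) k) ∧
    ∀ ψ, B ψ =ᵐ[dX N] fun X => ((entropyTerm V X + interactionTerm V X : ℝ) : ℂ) * ψ X := by
  obtain ⟨B, hB, hB1, hB2⟩ := exists_mulOp_eq_clm hW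
  refine ⟨B, hB, fun φ k => ?_, hB2⟩
  have h : hamiltonian V φ = (1 / 2 : ℂ) • negLaplacian N ⟨φ, φ.2.1⟩ +
      mulOp (fun X => entropyTerm V X + interactionTerm V X) ⟨φ, φ.2.2⟩ := rfl
  rw [h, hB1, map_add, map_smul, lp.coeFn_add, Pi.add_apply, lp.coeFn_smul, Pi.smul_apply,
    repr_negLaplacian, smul_eq_mul]
  push_cast
  ring

theorem hamiltonian_isSelfAdjoint_and_exists_isUnitaryGroup :
    IsSelfAdjoint (hamiltonian V) ∧
      ∃ U : ℝ → L2 N →L[ℂ] L2 N, IsUnitaryGroup (hamiltonian V) U := by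
  obtain ⟨B, hB, hH, -⟩ := exists_hamiltonian_eq hW
  refine isSelfAdjoint_and_exists_isUnitaryGroup (expBasis N) (a := fun k => symbol k / 2)
    (fun k => div_nonneg (symbol_nonneg k) zero_le_two) tendsto_symbol hB (fun x => ?_) hH
  rw [hamiltonian_domain hW, mem_H2_iff]

end Hamiltonian

section Permutations

lemma permOp_coeFn (σ : Equiv.Perm (Fin N)) (ψ : L2 N) :
    permOp σ ψ =ᵐ[dX N] fun X => ψ fun i => X (σ.symm i) :=
  Lp.coeFn_compMeasurePreserving ψ (measurePreserving_perm σ)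

lemma permOp_expBasis (σ : Equiv.Perm (Fin N)) (k : Fin N → ℤ) :
    permOp σ (expBasis N k) = expBasis N (fun i => k (σ i)) := by
  have hcoe : ∀ k, expBasis N k =ᵐ[dX N] UnitAddTorus.mFourier k := fun k => by
    have : expBasis N k = UnitAddTorus.mFourierLp 2 k := by
      rw [← UnitAddTorus.coe_mFourierBasis]
      rfl
    rw [this]
    exact UnitAddTorus.coeFn_mFourierLp 2 k
  refine Lp.ext ?_
  filter_upwards [permOp_coeFn σ (expBasis N k), hcoe (fun i => k (σ i)),
    (measurePreserving_perm σ).quasiMeasurePreserving.ae (hcoe k)] with X h1 h2 h3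
  rw [h1, h2, h3]
  simp only [UnitAddTorus.mFourier, ContinuousMap.coe_mk]
  rw [← Equiv.prod_comp σ]
  simp

lemma inner_permOp (σ : Equiv.Perm (Fin N)) (ψ φ : L2 N) :
    inner ℂ (permOp σ ψ) (permOp σ φ) = inner ℂ ψ φ :=
  (Lp.compMeasurePreservingₗᵢ ℂ _ (measurePreserving_perm σ)).inner_map_map ψ φ

lemma repr_permOp (σ : Equiv.Perm (Fin N)) (ψ : L2 N) (k : Fin N → ℤ) :
    (expBasis N).repr (permOp σ ψ) k = (expBasis N).repr ψ fun i => k (σ.symm i) := by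
  have h : expBasis N k = permOp σ (expBasis N fun i => k (σ.symm i)) := by
    rw [permOp_expBasis]
    simp
  rw [HilbertBasis.repr_apply_apply, HilbertBasis.repr_apply_apply, h, inner_permOp]

lemma symbol_perm (σ : Equiv.Perm (Fin N)) (k : Fin N → ℤ) :
    symbol (fun i => k (σ i)) = symbol k := by
  unfold symbol freqSq
  rw [Equiv.sum_comp σ fun i => (k i : ℝ) ^ 2]

lemma permOp_mem_H2 (σ : Equiv.Perm (Fin N)) {ψ : L2 N} (hψ : ψ ∈ H2 N) : permOp σ ψ ∈ H2 N := by
  rw [mem_H2_iff] at hψ ⊢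
  have h := ((Equiv.arrowCongr σ (Equiv.refl ℤ)).summable_iff).2 hψ
  refine h.congr fun k => ?_
  have : (Equiv.arrowCongr σ (Equiv.refl ℤ)) k = fun i => k (σ.symm i) := rfl
  rw [Function.comp_apply, this, repr_permOp, symbol_perm σ.symm]

/-- A Hamiltonian with symmetric potential energy commutes with permutations of the particles. -/
lemma permOp_hamiltonian {V : Config N → Circ → ℝ}
    (hW : Continuous fun X => entropyTerm V X + interactionTerm V X)
    (hsymm : ∀ (σ : Equiv.Perm (Fin N)) X,
      entropyTerm V (fun i => X (σ i)) + interactionTerm V (fun i => X (σ i)) =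
        entropyTerm V X + interactionTerm V X)
    (σ : Equiv.Perm (Fin N)) (φ : (hamiltonian V).domain) :
    ∃ h : permOp σ φ ∈ (hamiltonian V).domain,
      hamiltonian V ⟨permOp σ φ, h⟩ = permOp σ (hamiltonian V φ) := by
  obtain ⟨B, -, hH, hB⟩ := exists_hamiltonian_eq hW
  have hmem : permOp σ φ ∈ (hamiltonian V).domain :=
    (hamiltonian_domain hW).ge (permOp_mem_H2 σ ((hamiltonian_domain hW).le φ.2))
  have hBP : B (permOp σ φ) = permOp σ (B φ) := by
    refine Lp.ext ?_
    filter_upwards [hB (permOp σ φ), permOp_coeFn σ (φ : L2 N), permOp_coeFn σ (B φ),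
      (measurePreserving_perm σ).quasiMeasurePreserving.ae (hB φ)] with X h1 h2 h3 h4
    rw [h1, h2, h3, h4, hsymm σ.symm]
  refine ⟨hmem, hilbertBasis_ext (expBasis N) fun k => ?_⟩
  rw [hH, repr_permOp, repr_permOp, hH, symbol_perm σ.symm, hBP, repr_permOp]

end Permutations

section Density

lemma IsSymmDensity.hasSum {R : L2 N →L[ℂ] L2 N} (hR : IsSymmDensity R) :
    HasSum (fun k => (inner ℂ (expBasis N k) (R (expBasis N k))).re) 1 := by
  have h0 : ∀ k, 0 ≤ (inner ℂ (expBasis N k) (R (expBasis N k))).re := fun k =>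
    hR.isPositive.re_inner_nonneg_right _
  have h1 := hR.trace_eq_one
  unfold trace at h1
  have hs := summable_of_tsum_ofReal_ne_top h0 (by rw [h1]; exact ENNReal.one_ne_top)
  rw [← ENNReal.ofReal_tsum_of_nonneg h0 hs, ENNReal.ofReal_eq_one] at h1
  exact hs.hasSum_iff.2 h1

/-- A density operator is a contraction, by summing `|⟨e_k, R x⟩|² ≤ ⟨e_k, R e_k⟩ ⟨x, R x⟩`. -/
lemma IsSymmDensity.norm_le_one {R : L2 N →L[ℂ] L2 N} (hR : IsSymmDensity R) : ‖R‖ ≤ 1 := by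
  refine ContinuousLinearMap.opNorm_le_bound _ zero_le_one fun x => ?_
  have h1 : ‖R x‖ ^ 2 ≤ 1 * (inner ℂ x (R x)).re := by
    refine hasSum_le (fun k => ?_) (hasSum_norm_sq_repr (expBasis N) (R x))
      (hR.hasSum.mul_right _)
    rw [HilbertBasis.repr_apply_apply]
    exact norm_inner_apply_sq_le hR.isPositive _ _
  have h2 : (inner ℂ x (R x)).re ≤ ‖x‖ * ‖R x‖ := re_inner_le_norm (𝕜 := ℂ) x (R x)
  rw [one_mul] at h1 ⊢
  by_contra! h
  nlinarith [norm_nonneg x, norm_nonneg (R x)]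

/-- A density operator with finite second Laplacian moment maps `L²` into `H²`, by the
Cauchy–Schwarz inequality `|⟨e_k, R ψ⟩|² ≤ ⟨e_k, R e_k⟩ ⟨ψ, R ψ⟩`. -/
lemma IsSymmDensity.apply_mem_H2 {R : L2 N →L[ℂ] L2 N} (hR : IsSymmDensity R)
    (h : traceLaplacianSq R < ⊤) (ψ : L2 N) : R ψ ∈ H2 N := by
  have h0 : ∀ k, 0 ≤ symbol k ^ 2 * (inner ℂ (expBasis N k) (R (expBasis N k))).re := fun k =>
    mul_nonneg (sq_nonneg _) (hR.isPositive.re_inner_nonneg_right _)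
  have hs := summable_of_tsum_ofReal_ne_top h0 h.ne
  rw [mem_H2_iff]
  refine Summable.of_nonneg_of_le (fun k => by positivity) (fun k => ?_)
    (hs.mul_right (inner ℂ ψ (R ψ)).re)
  rw [HilbertBasis.repr_apply_apply, mul_assoc]
  refine mul_le_mul ?_ (norm_inner_apply_sq_le hR.isPositive _ _) (sq_nonneg _) (sq_nonneg _)
  have := symbol_nonneg k
  gcongr
  linarith

/-- Conjugation by the unitary group of a permutation invariant Hamiltonian preserves symmetric
density operators. -/
lemma IsSymmDensity.conj {H : L2 N →ₗ.[ℂ] L2 N} {U : ℝ → L2 N →L[ℂ] L2 N}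
    (hU : IsUnitaryGroup H U)
    (hP : ∀ (σ : Equiv.Perm (Fin N)) (φ : H.domain), ∃ h : permOp σ φ ∈ H.domain,
      H ⟨permOp σ φ, h⟩ = permOp σ (H φ))
    {R : L2 N →L[ℂ] L2 N} (hR : IsSymmDensity R) (t : ℝ) :
    IsSymmDensity (U t ∘L R ∘L U (-t)) := by
  have hone : ContinuousLinearMap.adjoint (U t) ∘L U t = 1 := by
    rw [hU.adjoint, ← hU.add, neg_add_cancel, hU.zero]
  rw [← hU.adjoint]
  refine ⟨hR.isPositive.conj_adjoint (U t), ?_, fun σ => ?_⟩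
  · exact (tsum_inner_conj_eq (expBasis N) hR.isPositive hone).trans hR.trace_eq_one
  · have h1 := hU.commute (permOp σ) (hP σ) t
    have h2 := congrArg ContinuousLinearMap.adjoint h1
    rw [ContinuousLinearMap.adjoint_comp, ContinuousLinearMap.adjoint_comp] at h2
    rw [← ContinuousLinearMap.comp_assoc, ← ContinuousLinearMap.comp_assoc, h1,
      ContinuousLinearMap.comp_assoc, ContinuousLinearMap.comp_assoc,
      ContinuousLinearMap.comp_assoc, h2, ← ContinuousLinearMap.comp_assoc R,
      ← ContinuousLinearMap.comp_assoc (permOp σ), hR.symm σ]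

end Density

end VonNeumann

end

theorem lemma5p2 (N : ℕ) (hN : 1 ≤ N)
    (Vt Vh : VonNeumann.Config N → VonNeumann.Circ → ℝ)
    (hV : ∀ X, VonNeumann.IsPoissonBoltzmann X (Vt X) (Vh X)) :
    ((VonNeumann.hamiltonian fun X x => Vt X x + Vh X x).domain = VonNeumann.H2 N ∧
      IsSelfAdjoint (VonNeumann.hamiltonian fun X x => Vt X x + Vh X x)) ∧
    ∀ Rin : VonNeumann.L2 N →L[ℂ] VonNeumann.L2 N,
      VonNeumann.IsSymmDensity Rin → VonNeumann.traceLaplacianSq Rin < ⊤ →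
      ∃ R : ℝ → VonNeumann.L2 N →L[ℂ] VonNeumann.L2 N,
        (R 0 = Rin ∧
          VonNeumann.IsSolution (VonNeumann.hamiltonian fun X x => Vt X x + Vh X x) (Ici 0) R) ∧
        ∀ T : ℝ, 0 < T → ∀ S : ℝ → VonNeumann.L2 N →L[ℂ] VonNeumann.L2 N,
          S 0 = Rin →
          VonNeumann.IsSolution (VonNeumann.hamiltonian fun X x => Vt X x + Vh X x) (Icc 0 T) S →
          ∀ t ∈ Icc 0 T, S t = R t := by
  have hW := VonNeumann.continuous_potential hN hV
  have hdom := VonNeumann.hamiltonian_domain hW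
  obtain ⟨hsa, U, hU⟩ := VonNeumann.hamiltonian_isSelfAdjoint_and_exists_isUnitaryGroup hW
  have hd := hsa.dense_domain
  have hP := VonNeumann.permOp_hamiltonian hW fun σ X => VonNeumann.potential_perm hN hV X σ
  refine ⟨⟨hdom, hsa⟩, fun Rin hRin hfin => ⟨fun t => U t ∘L Rin ∘L U (-t), ⟨?_, ?_⟩, ?_⟩⟩
  · simp only [neg_zero, hU.zero]
    rfl
  · intro t _
    refine ⟨hRin.conj hU hP t, fun φ => ?_⟩
    obtain ⟨h, hder⟩ := hU.hasDerivAt_conj hd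
      (fun x => by rw [hdom]; exact hRin.apply_mem_H2 hfin x) t φ
    exact ⟨h, hder.hasDerivWithinAt⟩
  · intro T _ S hS0 hS t ht
    rw [hU.eq_conj hd (fun s hs => (hS s hs).1.norm_le_one) (fun s hs => (hS s hs).2) ht, hS0]
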